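/- Let $\Bbbk$ be a field of characteristic $0$ and $H=\Bbbk[D]$. A \emph{conformal algebra} is an $H$-module $C$ with $\Bbbk$-bilinear products $(\cdot\circ_n\cdot)$, $n\ge 0$, such that for all $a,b\in C$: $a\circ_n b=0$ for almost all $n$, $Da\circ_n b=-n\,a\circ_{n-1}b$, and $a\circ_n Db=D(a\circ_n b)+n\,a\circ_{n-1}b$. Put $\{a\circ_n b\}=\sum_{s\ge0}\frac{(-1)^{n+s}}{s!}D^s(a\circ_{n+s}b)$. The algebra $C$ is \emph{associative} if $a\circ_n(b\circ_m c)=\sum_{s\ge0}\binom ns(a\circ_{n-s}b)\circ_{m+s}c$; an associative $C$ is \emph{commutative} if $a\circ_n b=\{b\circ_n a\}$; $C$ is a \emph{Lie} conformal algebra if $a\circ_n b=-\{b\circ_n a\}$ and $a\circ_n(b\circ_m c)-b\circ_m(a\circ_n c)=\sum_{s\ge0}\binom ns(a\circ_{n-s}b)\circ_{m+s}c$ (its products are then written $[a\circ_n b]$). It is \emph{finite} if it is a finitely generated $H$-module, and \emph{torsion-free} if it is so as an $H$-module. Let $L$ be a finite torsion-free Lie conformal algebra with a basis $B$ over $H$.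 For an integer $N\ge0$ let $U_N(L)$, with the map $\iota_N:L\to U_N(L)$, be the universal associative envelope of $L$ with locality bound $N$ on $B$. That is, $U_N(L)$ is the associative conformal algebra generated by $\iota_N(L)$, where $\iota_N$ is $H$-linear, $\iota_N([a\circ_n b])=\iota_N(a)\circ_n\iota_N(b)-\{\iota_N(b)\circ_n\iota_N(a)\}$ for all $a,b\in L$, $n\ge 0$, and $\iota_N(b)\circ_n\iota_N(b')=0$ for all $b,b'\in B$, $n\ge N$, and it is universal with these properties. Filter it by the $H$-submodules $U_i$, $i\ge 1$, spanned by all products, with any bracketing, of at most $i$ elements of $\iota_N(B)$, and let $\mathrm{gr}\,U_N(L)=\bigoplus_{i\ge1}U_i/U_{i-1}$ ($U_0=0$) be the associated graded conformal algebra. Let $\mathfrak F_N(B)$ be the free (associative and) commutative conformal algebra generated by $B$ subject to $b\circ_n b'=0$ for all $b,b'\in B$, $n\ge N$. Say that $L$ has the \emph{PBW property} with respect to $B$ if for all sufficiently large $N$ the conformal algebras $\mathrm{gr}\,U_N(L)$ and $\mathfrak F_N(B)$ are isomorphic. \textbf{Proposition.} If $L$ has the PBW property with respect to $B$, then $L$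 has a finite faithful representation on a free $H$-module. That is, there exist a finitely generated free $H$-module $M$ and $\Bbbk$-bilinear operations $(\cdot\circ_n\cdot):L\times M\to M$, $n\ge0$, such that for all $a,b\in L$, $v\in M$, $n,m\ge 0$: $a\circ_n v=0$ for almost all $n$; $Da\circ_n v=-n\,a\circ_{n-1}v$; $a\circ_n Dv=D(a\circ_n v)+n\,a\circ_{n-1}v$; $a\circ_n(b\circ_m v)-b\circ_m(a\circ_n v)=\sum_{s\ge0}\binom ns[a\circ_{n-s}b]\circ_{m+s}v$; and $a=0$ whenever $a\circ_n v=0$ for all $n\ge0$ and $v\in M$. -/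

import Mathlib

open Polynomial
open scoped DirectSum

universe u v w

namespace Conformal

/-! ## Conformal algebras

`H = k[X]` is the polynomial algebra in one variable, with `X` in the role of `D`. A module over `H`
is in particular a vector space over `k`, the scalar `c` acting as `C c`. -/

/-- A family of binary operations, one for every `n ≥ 0`. -/
class NProducts (A : Type*) where
  /-- `nprod n a b` is the `n`-product of `a` and `b`. -/
  nprod : ℕ → A → A → A

open NProducts (nprod)

/-- Conformal algebras over `k`: an `H`-module with `k`-bilinear `n`-products that satisfy the
locality axiom and sesqui-linearity. (For `n = 0` the terms with `n - 1` have coefficient `0`.) -/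
class IsConformalAlgebra (k : Type*) [Field k] (A : Type*) [AddCommGroup A] [Module k[X] A]
    [NProducts A] : Prop where
  add_nprod : ∀ (n : ℕ) (a b c : A), nprod n (a + b) c = nprod n a c + nprod n b c
  nprod_add : ∀ (n : ℕ) (a b c : A), nprod n a (b + c) = nprod n a b + nprod n a c
  smul_nprod : ∀ (n : ℕ) (r : k) (a b : A),
    nprod n ((C r : k[X]) • a) b = (C r : k[X]) • nprod n a b
  nprod_smul : ∀ (n : ℕ) (r : k) (a b : A),
    nprod n a ((C r : k[X]) • b) = (C r : k[X]) • nprod n a b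
  locality : ∀ a b : A, ∃ N : ℕ, ∀ n : ℕ, N ≤ n → nprod n a b = 0
  D_nprod : ∀ (n : ℕ) (a b : A),
    nprod n ((X : k[X]) • a) b = -(n • nprod (n - 1) a b)
  nprod_D : ∀ (n : ℕ) (a b : A),
    nprod n a ((X : k[X]) • b) = (X : k[X]) • nprod n a b + n • nprod (n - 1) a b

/-- `{a ∘ₙ b} = ∑_{s ≥ 0} (-1)^(n+s) / s! • D^s (a ∘ₙ₊ₛ b)`; in a conformal algebra the sum is finite
by locality. -/
noncomputable def braceProd (k : Type*) [Field k] {A : Type*} [AddCommGroup A] [Module k[X] A]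
    [NProducts A] (n : ℕ) (a b : A) : A :=
  ∑ᶠ s : ℕ, (C ((-1 : k) ^ (n + s) / (s.factorial : k)) * X ^ s : k[X]) • nprod (n + s) a b

/-- Associative conformal algebras. -/
class IsAssocConformalAlgebra (k : Type*) [Field k] (A : Type*) [AddCommGroup A] [Module k[X] A]
    [NProducts A] : Prop extends IsConformalAlgebra k A where
  assoc : ∀ (n m : ℕ) (a b c : A),
    nprod n a (nprod m b c) =
      ∑ s ∈ Finset.range (n + 1), n.choose s • nprod (m + s) (nprod (n - s) a b) c

/-- Lie conformal algebras; `nprod n a b` is the bracket `[a ∘ₙ b]`. -/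
class IsLieConformalAlgebra (k : Type*) [Field k] (A : Type*) [AddCommGroup A] [Module k[X] A]
    [NProducts A] : Prop extends IsConformalAlgebra k A where
  skew : ∀ (n : ℕ) (a b : A), nprod n a b = -braceProd k n b a
  jacobi : ∀ (n m : ℕ) (a b c : A),
    nprod n a (nprod m b c) - nprod m b (nprod n a c) =
      ∑ s ∈ Finset.range (n + 1), n.choose s • nprod (m + s) (nprod (n - s) a b) c

/-- Isomorphisms of conformal algebras: `H`-linear bijections that respect all `n`-products. -/
structure Iso (k : Type*) [Field k] (A A' : Type*) [AddCommGroup A] [Module k[X] A] [NProducts A]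
    [AddCommGroup A'] [Module k[X] A'] [NProducts A'] extends A ≃ₗ[k[X]] A' where
  map_nprod : ∀ (n : ℕ) (a b : A), toFun (nprod n a b) = nprod n (toFun a) (toFun b)

section Basic

variable {k : Type*} [Field k] {A : Type*} [AddCommGroup A] [Module k[X] A] [NProducts A]

theorem zero_nprod [IsConformalAlgebra k A] (n : ℕ) (b : A) : nprod n (0 : A) b = 0 := by
  have h := IsConformalAlgebra.add_nprod k n (0 : A) 0 b
  simpa using h

theorem nprod_zero [IsConformalAlgebra k A] (n : ℕ) (a : A) : nprod n a (0 : A) = 0 := by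
  have h := IsConformalAlgebra.nprod_add k n a (0 : A) 0
  simpa using h

theorem neg_nprod [IsConformalAlgebra k A] (n : ℕ) (a b : A) :
    nprod n (-a) b = -nprod n a b := by
  rw [eq_neg_iff_add_eq_zero, ← IsConformalAlgebra.add_nprod k, neg_add_cancel, zero_nprod (k := k)]

theorem nprod_neg [IsConformalAlgebra k A] (n : ℕ) (a b : A) :
    nprod n a (-b) = -nprod n a b := by
  rw [eq_neg_iff_add_eq_zero, ← IsConformalAlgebra.nprod_add k, neg_add_cancel, nprod_zero (k := k)]

end Basic

/-! ## Ideals and quotients -/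

section Ideal

variable (k : Type*) [Field k] {A : Type*} [AddCommGroup A] [Module k[X] A] [NProducts A]

/-- The (two-sided) ideal generated by a set: the least `H`-submodule that contains it and absorbs
all `n`-products. -/
noncomputable def idealSpan (S : Set A) : Submodule k[X] A :=
  sInf {I | S ⊆ I ∧ ∀ (n : ℕ) (a b : A), a ∈ I → nprod n a b ∈ I ∧ nprod n b a ∈ I}

variable {k}

theorem nprod_mem_idealSpan_left {S : Set A} (n : ℕ) {a : A} (b : A) (h : a ∈ idealSpan k S) :
    nprod n a b ∈ idealSpan k S := by
  simp only [idealSpan, Submodule.mem_sInf] at h ⊢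
  exact fun I hI => (hI.2 n a b (h I hI)).1

theorem nprod_mem_idealSpan_right {S : Set A} (n : ℕ) {a : A} (b : A) (h : a ∈ idealSpan k S) :
    nprod n b a ∈ idealSpan k S := by
  simp only [idealSpan, Submodule.mem_sInf] at h ⊢
  exact fun I hI => (hI.2 n a b (h I hI)).2

/-- The `n`-products of a quotient by an ideal. -/
noncomputable instance quotientNProducts [IsConformalAlgebra k A] (S : Set A) :
    NProducts (A ⧸ idealSpan k S) where
  nprod n := Quotient.map₂ (nprod n) (by
    intro a a' ha b b' hb
    have ha' : a - a' ∈ idealSpan k S := (Submodule.quotientRel_def _).1 ha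
    have hb' : b - b' ∈ idealSpan k S := (Submodule.quotientRel_def _).1 hb
    refine (Submodule.quotientRel_def _).2 ?_
    have h : nprod n a b - nprod n a' b' = nprod n (a - a') b + nprod n a' (b - b') := by
      rw [sub_eq_add_neg a, sub_eq_add_neg b, IsConformalAlgebra.add_nprod k,
        IsConformalAlgebra.nprod_add k, neg_nprod (k := k), nprod_neg (k := k)]
      abel
    rw [h]
    exact add_mem (nprod_mem_idealSpan_left n b ha') (nprod_mem_idealSpan_right n a' hb'))

theorem mk_nprod [IsConformalAlgebra k A] (S : Set A) (n : ℕ) (a b : A) :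
    (Submodule.Quotient.mk (nprod n a b) : A ⧸ idealSpan k S) =
      nprod n (Submodule.Quotient.mk a) (Submodule.Quotient.mk b) := rfl

instance quotient_isConformalAlgebra [IsConformalAlgebra k A] (S : Set A) :
    IsConformalAlgebra k (A ⧸ idealSpan k S) where
  add_nprod n a b c := by
    induction a using Submodule.Quotient.induction_on with | _ a
    induction b using Submodule.Quotient.induction_on with | _ b
    induction c using Submodule.Quotient.induction_on with | _ c
    simp only [← Submodule.Quotient.mk_add, ← mk_nprod, IsConformalAlgebra.add_nprod k]
  nprod_add n a b c := by
    induction a using Submodule.Quotient.induction_on with | _ a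
    induction b using Submodule.Quotient.induction_on with | _ b
    induction c using Submodule.Quotient.induction_on with | _ c
    simp only [← Submodule.Quotient.mk_add, ← mk_nprod, IsConformalAlgebra.nprod_add k]
  smul_nprod n r a b := by
    induction a using Submodule.Quotient.induction_on with | _ a
    induction b using Submodule.Quotient.induction_on with | _ b
    simp only [← Submodule.Quotient.mk_smul, ← mk_nprod, IsConformalAlgebra.smul_nprod]
  nprod_smul n r a b := by
    induction a using Submodule.Quotient.induction_on with | _ a
    induction b using Submodule.Quotient.induction_on with | _ b
    simp only [← Submodule.Quotient.mk_smul, ← mk_nprod, IsConformalAlgebra.nprod_smul]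
  locality a b := by
    induction a using Submodule.Quotient.induction_on with | _ a
    induction b using Submodule.Quotient.induction_on with | _ b
    obtain ⟨N, hN⟩ := IsConformalAlgebra.locality k a b
    exact ⟨N, fun n hn => by rw [← mk_nprod, hN n hn, Submodule.Quotient.mk_zero]⟩
  D_nprod n a b := by
    induction a using Submodule.Quotient.induction_on with | _ a
    induction b using Submodule.Quotient.induction_on with | _ b
    simp only [← Submodule.Quotient.mk_smul, ← mk_nprod, IsConformalAlgebra.D_nprod,
      Submodule.Quotient.mk_neg]
  nprod_D n a b := by
    induction a using Submodule.Quotient.induction_on with | _ a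
    induction b using Submodule.Quotient.induction_on with | _ b
    simp only [← Submodule.Quotient.mk_smul, ← mk_nprod, IsConformalAlgebra.nprod_D,
      Submodule.Quotient.mk_add]

instance quotient_isAssocConformalAlgebra [IsAssocConformalAlgebra k A] (S : Set A) :
    IsAssocConformalAlgebra k (A ⧸ idealSpan k S) where
  assoc n m a b c := by
    induction a using Submodule.Quotient.induction_on with | _ a
    induction b using Submodule.Quotient.induction_on with | _ b
    induction c using Submodule.Quotient.induction_on with | _ c
    rw [← mk_nprod, ← mk_nprod, IsAssocConformalAlgebra.assoc k n m a b c, ← Submodule.mkQ_apply,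
      map_sum]
    exact Finset.sum_congr rfl fun s _ => map_nsmul _ _ _

end Ideal

/-! ## Free associative conformal algebras with a given locality function -/

section Free

/-- Formal expressions in the generators `β` built from `H`-module operations and `n`-products. -/
inductive Expr (k : Type u) [Field k] (β : Type w) : Type (max u w)
  | gen : β → Expr k β
  | zero : Expr k β
  | add : Expr k β → Expr k β → Expr k β
  | smul : k[X] → Expr k β → Expr k β
  | prod : ℕ → Expr k β → Expr k β → Expr k β

/-- `f 0 + ... + f (n - 1)`. -/
def Expr.sum {k : Type u} [Field k] {β : Type w} (f : ℕ → Expr k β) : ℕ → Expr k β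
  | 0 => .zero
  | n + 1 => .add (Expr.sum f n) (f n)

/-- The least congruence on formal expressions that imposes the laws of an `H`-module, bilinearity
and sesqui-linearity of the `n`-products, associativity, and locality `N` on the generators. -/
inductive FreeRel (k : Type u) [Field k] {β : Type w} (N : β → β → ℕ) :
    Expr k β → Expr k β → Prop
  | refl (a) : FreeRel k N a a
  | symm {a b} : FreeRel k N a b → FreeRel k N b a
  | trans {a b c} : FreeRel k N a b → FreeRel k N b c → FreeRel k N a c
  | add_congr {a a' b b'} : FreeRel k N a a' → FreeRel k N b b' →
      FreeRel k N (.add a b) (.add a' b')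
  | smul_congr (f) {a a'} : FreeRel k N a a' → FreeRel k N (.smul f a) (.smul f a')
  | prod_congr (n) {a a' b b'} : FreeRel k N a a' → FreeRel k N b b' →
      FreeRel k N (.prod n a b) (.prod n a' b')
  | add_assoc (a b c) : FreeRel k N (.add (.add a b) c) (.add a (.add b c))
  | add_comm (a b) : FreeRel k N (.add a b) (.add b a)
  | zero_add (a) : FreeRel k N (.add .zero a) a
  | smul_add (f a b) : FreeRel k N (.smul f (.add a b)) (.add (.smul f a) (.smul f b))
  | add_smul (f g a) : FreeRel k N (.smul (f + g) a) (.add (.smul f a) (.smul g a))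
  | mul_smul (f g a) : FreeRel k N (.smul (f * g) a) (.smul f (.smul g a))
  | one_smul (a) : FreeRel k N (.smul 1 a) a
  | zero_smul (a) : FreeRel k N (.smul 0 a) .zero
  | add_prod (n a b c) :
      FreeRel k N (.prod n (.add a b) c) (.add (.prod n a c) (.prod n b c))
  | prod_add (n a b c) :
      FreeRel k N (.prod n a (.add b c)) (.add (.prod n a b) (.prod n a c))
  | smul_prod (n) (r : k) (a b) :
      FreeRel k N (.prod n (.smul (C r) a) b) (.smul (C r) (.prod n a b))
  | prod_smul (n) (r : k) (a b) :
      FreeRel k N (.prod n a (.smul (C r) b)) (.smul (C r) (.prod n a b))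
  | D_prod (n : ℕ) (a b) :
      FreeRel k N (.prod n (.smul X a) b) (.smul (-(n : k[X])) (.prod (n - 1) a b))
  | prod_D (n : ℕ) (a b) :
      FreeRel k N (.prod n a (.smul X b))
        (.add (.smul X (.prod n a b)) (.smul (n : k[X]) (.prod (n - 1) a b)))
  | assoc (n m : ℕ) (a b c) :
      FreeRel k N (.prod n a (.prod m b c))
        (.sum (fun s => .smul (n.choose s : k[X]) (.prod (m + s) (.prod (n - s) a b) c)) (n + 1))
  | locality (n : ℕ) (x y : β) : N x y ≤ n → FreeRel k N (.prod n (.gen x) (.gen y)) .zero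

/-- `FreeRel` as an equivalence relation. -/
def freeSetoid (k : Type u) [Field k] {β : Type w} (N : β → β → ℕ) : Setoid (Expr k β) where
  r := FreeRel k N
  iseqv := ⟨.refl, .symm, .trans⟩

/-- The free associative conformal algebra generated by `β` with respect to the locality
function `N`. -/
def FreeAssoc (k : Type u) [Field k] {β : Type w} (N : β → β → ℕ) : Type (max u w) :=
  Quotient (freeSetoid k N)

namespace FreeAssoc

variable {k : Type u} [Field k] {β : Type w} {N : β → β → ℕ}

/-- The class of a formal expression. -/
def mk (N : β → β → ℕ) (a : Expr k β) : FreeAssoc k N := Quotient.mk (freeSetoid k N) a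

theorem mk_eq {a b : Expr k β} (h : FreeRel k N a b) : mk N a = mk N b :=
  Quotient.sound (s := freeSetoid k N) h

theorem ind {p : FreeAssoc k N → Prop} (h : ∀ a, p (mk N a)) (x : FreeAssoc k N) : p x :=
  Quotient.ind (s := freeSetoid k N) h x

/-- The generators. -/
def of (k : Type u) [Field k] {β : Type w} (N : β → β → ℕ) (x : β) : FreeAssoc k N :=
  mk N (.gen x)

instance : Zero (FreeAssoc k N) := ⟨mk N .zero⟩
instance : Add (FreeAssoc k N) :=
  ⟨Quotient.map₂ Expr.add fun _ _ h _ _ h' => FreeRel.add_congr h h'⟩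
instance : SMul k[X] (FreeAssoc k N) :=
  ⟨fun f => Quotient.map (Expr.smul f) fun _ _ h => FreeRel.smul_congr f h⟩
instance : NProducts (FreeAssoc k N) :=
  ⟨fun n => Quotient.map₂ (Expr.prod n) fun _ _ h _ _ h' => FreeRel.prod_congr n h h'⟩

theorem mk_zero : mk N (.zero : Expr k β) = 0 := rfl
theorem mk_add (a b : Expr k β) : mk N (.add a b) = mk N a + mk N b := rfl
theorem mk_smul (f : k[X]) (a : Expr k β) : mk N (.smul f a) = f • mk N a := rfl
theorem mk_prod (n : ℕ) (a b : Expr k β) : mk N (.prod n a b) = nprod n (mk N a) (mk N b) := rfl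

noncomputable instance : Neg (FreeAssoc k N) := ⟨fun a => (-1 : k[X]) • a⟩

noncomputable instance : AddCommGroup (FreeAssoc k N) :=
  have zero_add' : ∀ a : FreeAssoc k N, 0 + a = a := ind fun a => mk_eq (.zero_add a)
  have add_comm' : ∀ a b : FreeAssoc k N, a + b = b + a :=
    ind fun a => ind fun b => mk_eq (.add_comm a b)
  { add_assoc := ind fun a => ind fun b => ind fun c => mk_eq (.add_assoc a b c)
    zero_add := zero_add'
    add_zero := fun a => by rw [add_comm', zero_add']
    nsmul := nsmulRec
    zsmul := zsmulRec
    neg_add_cancel := ind fun a => by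
      have h1 : mk N (.smul 1 a) = mk N a := mk_eq (.one_smul a)
      have h2 := mk_eq (N := N) (.add_smul (-1) 1 a)
      have h3 := mk_eq (N := N) (.zero_smul a)
      rw [neg_add_cancel, mk_add, h1, h3] at h2
      exact h2.symm
    add_comm := add_comm' }

noncomputable instance : Module k[X] (FreeAssoc k N) where
  one_smul := ind fun a => mk_eq (.one_smul a)
  mul_smul f g := ind fun a => mk_eq (.mul_smul f g a)
  smul_zero f := by
    have h := mk_eq (N := N) (.zero_smul (.zero : Expr k β))
    have h' := mk_eq (N := N) (.mul_smul f 0 (.zero : Expr k β))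
    rw [mk_smul f, h, mul_zero, h] at h'
    exact h'.symm
  smul_add f := ind fun a => ind fun b => mk_eq (.smul_add f a b)
  add_smul f g := ind fun a => mk_eq (.add_smul f g a)
  zero_smul := ind fun a => mk_eq (.zero_smul a)

theorem mk_sum (f : ℕ → Expr k β) (n : ℕ) :
    mk N (.sum f n) = ∑ s ∈ Finset.range n, mk N (f s) := by
  induction n with
  | zero => rfl
  | succ n ih => rw [Finset.sum_range_succ, ← ih]; rfl

theorem nprod_assoc (n m : ℕ) (a b c : FreeAssoc k N) :
    nprod n a (nprod m b c) =
      ∑ s ∈ Finset.range (n + 1), n.choose s • nprod (m + s) (nprod (n - s) a b) c := by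
  induction a using ind with | _ a
  induction b using ind with | _ b
  induction c using ind with | _ c
  have h := mk_eq (N := N) (.assoc n m a b c)
  rw [mk_sum] at h
  simpa only [mk_smul, mk_prod, Nat.cast_smul_eq_nsmul] using h

theorem D_nprod (n : ℕ) (a b : FreeAssoc k N) :
    nprod n ((X : k[X]) • a) b = -(n • nprod (n - 1) a b) := by
  induction a using ind with | _ a
  induction b using ind with | _ b
  have h := mk_eq (N := N) (.D_prod n a b)
  simpa only [mk_smul, mk_prod, neg_smul, Nat.cast_smul_eq_nsmul] using h

theorem nprod_D (n : ℕ) (a b : FreeAssoc k N) :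
    nprod n a ((X : k[X]) • b) = (X : k[X]) • nprod n a b + n • nprod (n - 1) a b := by
  induction a using ind with | _ a
  induction b using ind with | _ b
  have h := mk_eq (N := N) (.prod_D n a b)
  simpa only [mk_smul, mk_add, mk_prod, Nat.cast_smul_eq_nsmul] using h

theorem add_nprod (n : ℕ) (a b c : FreeAssoc k N) :
    nprod n (a + b) c = nprod n a c + nprod n b c := by
  induction a using ind with | _ a
  induction b using ind with | _ b
  induction c using ind with | _ c
  exact mk_eq (.add_prod n a b c)

theorem nprod_add (n : ℕ) (a b c : FreeAssoc k N) :
    nprod n a (b + c) = nprod n a b + nprod n a c := by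
  induction a using ind with | _ a
  induction b using ind with | _ b
  induction c using ind with | _ c
  exact mk_eq (.prod_add n a b c)

theorem smul_nprod (n : ℕ) (r : k) (a b : FreeAssoc k N) :
    nprod n ((C r : k[X]) • a) b = (C r : k[X]) • nprod n a b := by
  induction a using ind with | _ a
  induction b using ind with | _ b
  exact mk_eq (.smul_prod n r a b)

theorem nprod_smul (n : ℕ) (r : k) (a b : FreeAssoc k N) :
    nprod n a ((C r : k[X]) • b) = (C r : k[X]) • nprod n a b := by
  induction a using ind with | _ a
  induction b using ind with | _ b
  exact mk_eq (.prod_smul n r a b)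

/-- A pair is local if almost all of its `n`-products vanish. -/
def Local (a b : FreeAssoc k N) : Prop := ∃ M : ℕ, ∀ n : ℕ, M ≤ n → nprod n a b = 0

theorem zero_nprod' (n : ℕ) (b : FreeAssoc k N) : nprod n 0 b = 0 := by
  simpa using add_nprod n (0 : FreeAssoc k N) 0 b

theorem nprod_zero' (n : ℕ) (b : FreeAssoc k N) : nprod n b 0 = 0 := by
  simpa using nprod_add n b (0 : FreeAssoc k N) 0

theorem Local.zero_left (b : FreeAssoc k N) : Local 0 b := ⟨0, fun n _ => zero_nprod' n b⟩

theorem Local.zero_right (b : FreeAssoc k N) : Local b 0 := ⟨0, fun n _ => nprod_zero' n b⟩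

theorem Local.add_left {a a' b : FreeAssoc k N} (h : Local a b) (h' : Local a' b) :
    Local (a + a') b := by
  obtain ⟨M, hM⟩ := h
  obtain ⟨M', hM'⟩ := h'
  exact ⟨M + M', fun n hn => by
    rw [add_nprod, hM n (by omega), hM' n (by omega), add_zero]⟩

theorem Local.add_right {a b b' : FreeAssoc k N} (h : Local a b) (h' : Local a b') :
    Local a (b + b') := by
  obtain ⟨M, hM⟩ := h
  obtain ⟨M', hM'⟩ := h'
  exact ⟨M + M', fun n hn => by
    rw [nprod_add, hM n (by omega), hM' n (by omega), add_zero]⟩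

theorem Local.smul_left (f : k[X]) {a b : FreeAssoc k N} (h : Local a b) : Local (f • a) b := by
  induction f using Polynomial.induction_on generalizing a with
  | C r =>
    obtain ⟨M, hM⟩ := h
    exact ⟨M, fun n hn => by rw [smul_nprod, hM n hn, smul_zero]⟩
  | add f g hf hg => rw [add_smul]; exact (hf h).add_left (hg h)
  | monomial i r ih =>
    rw [pow_succ, ← _root_.mul_assoc, mul_smul]
    refine ih ?_
    obtain ⟨M, hM⟩ := h
    exact ⟨M + 1, fun n hn => by rw [D_nprod, hM (n - 1) (by omega), smul_zero, neg_zero]⟩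

theorem Local.smul_right (f : k[X]) {a b : FreeAssoc k N} (h : Local a b) : Local a (f • b) := by
  induction f using Polynomial.induction_on generalizing b with
  | C r =>
    obtain ⟨M, hM⟩ := h
    exact ⟨M, fun n hn => by rw [nprod_smul, hM n hn, smul_zero]⟩
  | add f g hf hg => rw [add_smul]; exact (hf h).add_right (hg h)
  | monomial i r ih =>
    rw [pow_succ, ← _root_.mul_assoc, mul_smul]
    refine ih ?_
    obtain ⟨M, hM⟩ := h
    exact ⟨M + 1, fun n hn => by
      rw [nprod_D, hM (n - 1) (by omega), hM n (by omega), smul_zero, smul_zero, add_zero]⟩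

theorem nprod_nprod_eq_zero {b c : FreeAssoc k N} {M : ℕ}
    (hM : ∀ n : ℕ, M ≤ n → nprod n b c = 0) (a : FreeAssoc k N) (n m : ℕ) (hm : M ≤ m) :
    nprod m (nprod n a b) c = 0 := by
  induction n using Nat.strong_induction_on generalizing m with
  | _ n ih =>
    have h := nprod_assoc n m a b c
    rw [hM m hm, nprod_zero', Finset.sum_range_succ', Finset.sum_eq_zero] at h
    · simpa using h.symm
    · intro s hs
      rw [Finset.mem_range] at hs
      rw [ih (n - (s + 1)) (by omega) _ (by omega), smul_zero]

theorem Local.nprod_left {b c : FreeAssoc k N} (h : Local b c) (n : ℕ) (a : FreeAssoc k N) :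
    Local (nprod n a b) c := by
  obtain ⟨M, hM⟩ := h
  exact ⟨M, fun m hm => nprod_nprod_eq_zero hM a n m hm⟩

theorem Local.nprod_right {a b c : FreeAssoc k N} (h : Local a b) (h' : Local b c) (m : ℕ) :
    Local a (nprod m b c) := by
  obtain ⟨M, hM⟩ := h
  obtain ⟨M', hM'⟩ := h'
  refine ⟨M + M', fun n hn => ?_⟩
  rw [nprod_assoc]
  refine Finset.sum_eq_zero fun s hs => ?_
  by_cases hs' : M ≤ n - s
  · rw [hM _ hs', zero_nprod', smul_zero]
  · rw [nprod_nprod_eq_zero hM' a (n - s) (m + s) (by omega), smul_zero]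

theorem local_all (a b : FreeAssoc k N) : Local a b := by
  induction b using ind with | _ b
  induction b generalizing a with
  | gen y =>
    induction a using ind with | _ a
    induction a with
    | gen x => exact ⟨N x y, fun n hn => mk_eq (.locality n x y hn)⟩
    | zero => exact .zero_left _
    | add a a' h h' => exact h.add_left h'
    | smul f a h => exact h.smul_left f
    | prod n a a' _ h' => exact h'.nprod_left n (mk N a)
  | zero => exact .zero_right _
  | add b b' h h' => exact (h a).add_right (h' a)
  | smul f b h => exact (h a).smul_right f
  | prod n b b' h h' => exact (h a).nprod_right (h' _) n

instance : IsAssocConformalAlgebra k (FreeAssoc k N) where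
  add_nprod := add_nprod
  nprod_add := nprod_add
  smul_nprod := smul_nprod
  nprod_smul := nprod_smul
  locality := local_all
  D_nprod := D_nprod
  nprod_D := nprod_D
  assoc := nprod_assoc

end FreeAssoc

/-- The relations `a ∘ₙ b = {b ∘ₙ a}` of commutativity. -/
def commRelations (k : Type*) [Field k] (A : Type*) [AddCommGroup A] [Module k[X] A]
    [NProducts A] : Set A :=
  {x | ∃ (n : ℕ) (a b : A), x = nprod n a b - braceProd k n b a}

/-- The free (associative and) commutative conformal algebra generated by `β` with respect to the
locality function `N`. -/
abbrev FreeComm (k : Type u) [Field k] {β : Type w} (N : β → β → ℕ) : Type (max u w) :=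
  FreeAssoc k N ⧸ idealSpan k (commRelations k (FreeAssoc k N))

end Free

/-! ## Universal associative envelopes of a Lie conformal algebra with a basis over `H` -/

section Envelope

variable {k : Type u} [Field k] {L : Type v} [AddCommGroup L] [Module k[X] L] [NProducts L]
  {β : Type w}

/-- The `H`-linear map from `L` to the free associative conformal algebra on `β` that sends every
basis element to the corresponding generator. -/
noncomputable def toFree (B : Module.Basis β k[X] L) (N : β → β → ℕ) :
    L →ₗ[k[X]] FreeAssoc k N :=
  B.constr k[X] (FreeAssoc.of k N)

/-- The relations `a ∘ₙ b - {b ∘ₙ a} = [a ∘ₙ b]` for `a, b ∈ L`. -/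
def envelopeRelations (B : Module.Basis β k[X] L) (N : β → β → ℕ) : Set (FreeAssoc k N) :=
  {x | ∃ (n : ℕ) (a b : L),
    x = nprod n (toFree B N a) (toFree B N b) - braceProd k n (toFree B N b) (toFree B N a) -
      toFree B N (nprod n a b)}

/-- The universal associative envelope `U_N(L)` with respect to the locality function `N` on the
basis `B`. -/
abbrev Envelope (B : Module.Basis β k[X] L) (N : β → β → ℕ) : Type (max u w) :=
  FreeAssoc k N ⧸ idealSpan k (envelopeRelations B N)

/-- The canonical map `ι_N : L → U_N(L)`. -/
noncomputable def Envelope.ι (B : Module.Basis β k[X] L) (N : β → β → ℕ) :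
    L →ₗ[k[X]] Envelope B N :=
  (idealSpan k (envelopeRelations B N)).mkQ ∘ₗ toFree B N

end Envelope

/-! ## The filtration by degree in the generators and the associated graded algebra -/

section Graded

/-- `IsWord S l x`: `x` is a product, with any bracketing and any `n`-products, of `l ≥ 1` elements
of `S`. -/
inductive IsWord {A : Type*} [NProducts A] (S : Set A) : ℕ → A → Prop
  | gen {a : A} : a ∈ S → IsWord S 1 a
  | prod {i j : ℕ} {a b : A} (n : ℕ) : IsWord S i a → IsWord S j b →
      IsWord S (i + j) (nprod n a b)

theorem IsWord.pos {A : Type*} [NProducts A] {S : Set A} {l : ℕ} {x : A} (h : IsWord S l x) : 0 < l := by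
  induction h with
  | gen _ => exact Nat.one_pos
  | prod _ _ _ h _ => omega

variable (k : Type*) [Field k] {A : Type*} [AddCommGroup A] [Module k[X] A] [NProducts A]

/-- The `i`-th term of the filtration: the `H`-span of all words of length at most `i` in `S`. As
words have positive length, the term with `i = 0` is zero. -/
noncomputable def filt (S : Set A) (i : ℕ) : Submodule k[X] A :=
  Submodule.span k[X] {x | ∃ l ≤ i, IsWord S l x}

variable {k}

theorem filt_zero (S : Set A) : filt k S 0 = ⊥ := by
  rw [filt, Submodule.span_eq_bot]
  rintro x ⟨l, hl, hx⟩
  have := hx.pos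
  omega

variable [IsConformalAlgebra k A]

theorem smul_nprod_mem (I : Submodule k[X] A) (a b : A) (h : ∀ n, nprod n a b ∈ I) (f : k[X])
    (n : ℕ) : nprod n (f • a) b ∈ I := by
  induction f using Polynomial.induction_on generalizing a n with
  | C r => rw [IsConformalAlgebra.smul_nprod]; exact I.smul_mem _ (h n)
  | add f g hf hg =>
    rw [add_smul, IsConformalAlgebra.add_nprod k]; exact I.add_mem (hf a h n) (hg a h n)
  | monomial i r ih =>
    rw [pow_succ, ← mul_assoc, mul_smul]
    refine ih _ (fun m => ?_) n
    rw [IsConformalAlgebra.D_nprod]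
    exact I.neg_mem (I.smul_of_tower_mem m (h _))

theorem nprod_smul_mem (I : Submodule k[X] A) (a b : A) (h : ∀ n, nprod n a b ∈ I) (f : k[X])
    (n : ℕ) : nprod n a (f • b) ∈ I := by
  induction f using Polynomial.induction_on generalizing b n with
  | C r => rw [IsConformalAlgebra.nprod_smul]; exact I.smul_mem _ (h n)
  | add f g hf hg =>
    rw [add_smul, IsConformalAlgebra.nprod_add k]; exact I.add_mem (hf b h n) (hg b h n)
  | monomial i r ih =>
    rw [pow_succ, ← mul_assoc, mul_smul]
    refine ih _ (fun m => ?_) n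
    rw [IsConformalAlgebra.nprod_D]
    exact I.add_mem (I.smul_mem _ (h _)) (I.smul_of_tower_mem m (h _))

theorem nprod_mem_filt {S : Set A} {i j : ℕ} {a b : A} (ha : a ∈ filt k S i)
    (hb : b ∈ filt k S j) (n : ℕ) : nprod n a b ∈ filt k S (i + j) := by
  induction ha using Submodule.span_induction generalizing n with
  | mem a ha =>
    induction hb using Submodule.span_induction generalizing n with
    | mem b hb =>
      obtain ⟨l, hl, ha⟩ := ha
      obtain ⟨l', hl', hb⟩ := hb
      exact Submodule.subset_span ⟨l + l', by omega, ha.prod n hb⟩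
    | zero => rw [nprod_zero (k := k)]; exact zero_mem _
    | add b b' _ _ h h' => rw [IsConformalAlgebra.nprod_add k]; exact add_mem (h n) (h' n)
    | smul f b _ h => exact nprod_smul_mem _ a b h f n
  | zero => rw [zero_nprod (k := k)]; exact zero_mem _
  | add a a' _ _ h h' => rw [IsConformalAlgebra.add_nprod k]; exact add_mem (h n) (h' n)
  | smul f a _ h => exact smul_nprod_mem _ a b h f n

theorem nprod_mem_filt_pred_left {S : Set A} {i j : ℕ} {a b : A} (ha : a ∈ filt k S (i - 1))
    (hb : b ∈ filt k S j) (n : ℕ) : nprod n a b ∈ filt k S (i + j - 1) := by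
  rcases Nat.eq_zero_or_pos i with rfl | hi
  · rw [Nat.zero_sub, filt_zero, Submodule.mem_bot] at ha
    rw [ha, zero_nprod (k := k)]; exact zero_mem _
  · have h := nprod_mem_filt ha hb n
    rwa [show i - 1 + j = i + j - 1 by omega] at h

theorem nprod_mem_filt_pred_right {S : Set A} {i j : ℕ} {a b : A} (ha : a ∈ filt k S i)
    (hb : b ∈ filt k S (j - 1)) (n : ℕ) : nprod n a b ∈ filt k S (i + j - 1) := by
  rcases Nat.eq_zero_or_pos j with rfl | hj
  · rw [Nat.zero_sub, filt_zero, Submodule.mem_bot] at hb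
    rw [hb, nprod_zero (k := k)]; exact zero_mem _
  · have h := nprod_mem_filt ha hb n
    rwa [show i + (j - 1) = i + j - 1 by omega] at h

variable (k) in
/-- The homogeneous component of degree `i` of the associated graded algebra: the `i`-th term of
the filtration modulo the preceding one. It is zero for `i = 0`. -/
abbrev GrComponent (S : Set A) (i : ℕ) : Type _ :=
  filt k S i ⧸ (filt k S (i - 1)).submoduleOf (filt k S i)

variable (k) in
/-- The `n`-product of homogeneous components, induced by the `n`-product of `A`. -/
noncomputable def grProd (S : Set A) (n i j : ℕ) :
    GrComponent k S i → GrComponent k S j → GrComponent k S (i + j) :=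
  Quotient.map₂ (fun a b => ⟨nprod n a.1 b.1, nprod_mem_filt a.2 b.2 n⟩) (by
    intro a a' ha b b' hb
    have ha' : a.1 - a'.1 ∈ filt k S (i - 1) :=
      (Submodule.quotientRel_def ((filt k S (i - 1)).submoduleOf (filt k S i))).1 ha
    have hb' : b.1 - b'.1 ∈ filt k S (j - 1) :=
      (Submodule.quotientRel_def ((filt k S (j - 1)).submoduleOf (filt k S j))).1 hb
    refine (Submodule.quotientRel_def _).2 ?_
    change nprod n a.1 b.1 - nprod n a'.1 b'.1 ∈ filt k S (i + j - 1)
    have h : nprod n a.1 b.1 - nprod n a'.1 b'.1 =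
        nprod n (a.1 - a'.1) b.1 + nprod n a'.1 (b.1 - b'.1) := by
      rw [sub_eq_add_neg a.1, sub_eq_add_neg b.1, IsConformalAlgebra.add_nprod k,
        IsConformalAlgebra.nprod_add k, neg_nprod (k := k), nprod_neg (k := k)]
      abel
    rw [h]
    exact add_mem (nprod_mem_filt_pred_left ha' b.2 n) (nprod_mem_filt_pred_right a'.2 hb' n))

variable (k) in
/-- `grProd` as a biadditive map. -/
noncomputable def grProdHom (S : Set A) (n i j : ℕ) :
    GrComponent k S i →+ GrComponent k S j →+ GrComponent k S (i + j) :=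
  AddMonoidHom.mk' (fun a => AddMonoidHom.mk' (grProd k S n i j a) (by
    intro b b'
    induction a using Submodule.Quotient.induction_on with | _ a
    induction b using Submodule.Quotient.induction_on with | _ b
    induction b' using Submodule.Quotient.induction_on with | _ b'
    exact congrArg Submodule.Quotient.mk
      (Subtype.ext (IsConformalAlgebra.nprod_add k n a.1 b.1 b'.1)))) (by
    intro a a'
    ext b
    induction a using Submodule.Quotient.induction_on with | _ a
    induction a' using Submodule.Quotient.induction_on with | _ a'
    induction b using Submodule.Quotient.induction_on with | _ b
    exact congrArg Submodule.Quotient.mk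
      (Subtype.ext (IsConformalAlgebra.add_nprod k n a.1 a'.1 b.1)))

variable (k) in
/-- The associated graded conformal algebra of `A` with respect to the filtration by length of
words in `S`. -/
abbrev Gr (S : Set A) : Type _ := ⨁ i : ℕ, GrComponent k S i

noncomputable instance grAddCommGroup (S : Set A) : AddCommGroup (Gr k S) :=
  DirectSum.instAddCommGroup (β := GrComponent k S)

noncomputable instance grNProducts (S : Set A) : NProducts (Gr k S) where
  nprod n a b :=
    DirectSum.toAddMonoid (fun i => AddMonoidHom.flip <| DirectSum.toAddMonoid fun j =>
      AddMonoidHom.flip <|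
        (DirectSum.of (GrComponent k S) (i + j)).compHom.comp (grProdHom k S n i j)) a b

end Graded

/-! ## The PBW property -/

/-- The Poincaré–Birkhoff–Witt property of `L` with respect to the basis `B`: for every sufficiently
large constant locality function `N`, the graded universal envelope `gr U_N(L)` (for the filtration
by length of words in the images of the basis elements) is isomorphic to the free commutative
conformal algebra generated by `B` with locality `N`. -/
def HasPBWProperty {k : Type u} [Field k] {L : Type v} [AddCommGroup L] [Module k[X] L]
    [NProducts L] {β : Type w} (B : Module.Basis β k[X] L) : Prop :=
  ∃ N₀ : ℕ, ∀ N : ℕ, N₀ ≤ N →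
    Nonempty (Iso k
      (Gr k (Set.range fun x : β => Envelope.ι B (fun _ _ => N) (B x)))
      (FreeComm k (fun _ _ : β => N)))

/-! ## Representations of Lie conformal algebras -/

/-- A representation of the Lie conformal algebra `L` on the `H`-module `M`, given by the operations
`a ∘ₙ v = ρ(a)ₙ v`: for every `a` the sequence `(ρ(a)ₙ)` is a (left) conformal endomorphism of `M`
(`act_add`, `act_smul`, `locality`, `act_D`), the map `ρ` is `H`-linear (`add_act`, `smul_act`,
`D_act`), and `ρ` respects the brackets (`jacobi`). -/
structure Representation (k : Type*) [Field k] (L : Type*) [AddCommGroup L] [Module k[X] L]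
    [NProducts L] (M : Type*) [AddCommGroup M] [Module k[X] M] where
  act : ℕ → L → M → M
  act_add : ∀ (n : ℕ) (a : L) (v w : M), act n a (v + w) = act n a v + act n a w
  act_smul : ∀ (n : ℕ) (r : k) (a : L) (v : M),
    act n a ((C r : k[X]) • v) = (C r : k[X]) • act n a v
  locality : ∀ (a : L) (v : M), ∃ N : ℕ, ∀ n : ℕ, N ≤ n → act n a v = 0
  act_D : ∀ (n : ℕ) (a : L) (v : M),
    act n a ((X : k[X]) • v) = (X : k[X]) • act n a v + n • act (n - 1) a v
  add_act : ∀ (n : ℕ) (a b : L) (v : M), act n (a + b) v = act n a v + act n b v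
  smul_act : ∀ (n : ℕ) (r : k) (a : L) (v : M),
    act n ((C r : k[X]) • a) v = (C r : k[X]) • act n a v
  D_act : ∀ (n : ℕ) (a : L) (v : M),
    act n ((X : k[X]) • a) v = -(n • act (n - 1) a v)
  jacobi : ∀ (n m : ℕ) (a b : L) (v : M),
    act n a (act m b v) - act m b (act n a v) =
      ∑ s ∈ Finset.range (n + 1), n.choose s • act (m + s) (nprod (n - s) a b) v

/-- A representation is faithful if `ρ` is injective. -/
def Representation.IsFaithful {k : Type*} [Field k] {L : Type*} [AddCommGroup L] [Module k[X] L]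
    [NProducts L] {M : Type*} [AddCommGroup M] [Module k[X] M] (ρ : Representation k L M) : Prop :=
  Function.Injective fun (a : L) (n : ℕ) (v : M) => ρ.act n a v

end Conformal

/-! Write `a_λ b` for the generating function `∑ λⁿ/n! (a ∘ₙ b)` and `[a_λ b] = a_λ b - b_{-λ-D} a`
for the commutator. In an associative conformal algebra `A` the commutator satisfies the Jacobi
identity and the Leibniz rule `[a_λ (b_μ c)] = [a_λ b]_{λ+μ} c + b_μ [a_λ c]`
(`lamBracket_lamBracket`, `lamBracket_lamProd`). The adjoint action of `L` on its image in `A =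
U_N(L)` is a finite representation, but it kills the centre. It is therefore extended by a cocycle:
`a` acts on `A × A` by `(v, w) ↦ ([a_λ v], [a_λ w] + λ a_λ v)`. Since `λ a_λ = -(Da)_λ`, the
off-diagonal entry is, up to sign, left multiplication by the image of `a` under the derivation `D`,
and a derivation followed by left multiplication is a cocycle by the Leibniz rule
(`commProd_shiftProd_cocycle`).

By the Leibniz rule again, `ι(L) × P` is invariant, where `P` is the `H`-span of all `ι(a) ∘ₙ ι(b)`;
locality makes `P` finitely generated. The torsion of this module is invariant too, and the quotient
by it is free because `H` is a principal ideal domain. An element `a` sends `(ι a, 0)` to vectors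
with second entries `(n + 1) (ι a ∘ₙ ι a)`. So faithfulness follows once it is known that only `a =
0` has all `ι a ∘ₙ ι a` torsion (`exists_faithful_free_of_nprod_notMem_torsion`).

This is the one place where PBW enters (`eq_zero_of_nprod_mem_torsion`). The given isomorphism from
`gr U_N(L)` to the free commutative algebra need neither be graded nor match generators, so only its
existence may be used. For every `i` in the index set of `B` the free commutative algebra maps to
the rank two algebra `Hx ⊕ Hx²` with `x³ = 0`, by sending the `i`-th generator to `x` and the others
to `0`. The coefficients of `x` give together a surjection from `gr U_N(L)` to `H^B` that kills
products, hence is determined on the degree one component, that is, on the image of `L`. Thus `L →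
H^B` is onto, and as `L ≅ H^B` is finitely generated, it is injective. For `a ≠ 0` some coordinate
`f` is nonzero, and the square of `f x` is given by `f(-λ) f(D+λ) x²`, which is nonzero and without
torsion. -/

namespace Conformal

open NProducts (nprod)

/-! ## Exponential generating sums -/

section ExpSum

variable {k : Type*} [Field k] {V : Type*} [AddCommGroup V] [Module k[X] V]

/-- A sequence that vanishes from some index on. -/
def EventuallyZero {V : Type*} [Zero V] (w : ℕ → V) : Prop := ∃ N, ∀ n, N ≤ n → w n = 0

/-- A double sequence that vanishes outside of some square. -/
def EventuallyZero₂ {V : Type*} [Zero V] (w : ℕ → ℕ → V) : Prop :=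
  ∃ N, ∀ n m, N ≤ n ∨ N ≤ m → w n m = 0

/-- `∑ pⁿ / n! • w n`. -/
noncomputable def expSum (p : k[X]) (w : ℕ → V) : V :=
  ∑ᶠ n, (C ((n.factorial : k)⁻¹) * p ^ n) • w n

theorem expSum_eq {w : ℕ → V} {N : ℕ} (h : ∀ n, N ≤ n → w n = 0) (p : k[X]) :
    expSum p w = ∑ n ∈ Finset.range N, (C ((n.factorial : k)⁻¹) * p ^ n) • w n := by
  refine finsum_eq_sum_of_support_subset _ fun n hn => ?_
  rw [Finset.coe_range, Set.mem_Iio]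
  by_contra hN
  exact hn (by dsimp only; rw [h n (not_lt.1 hN), smul_zero])

theorem EventuallyZero.add {w w' : ℕ → V} (h : EventuallyZero w) (h' : EventuallyZero w') :
    EventuallyZero fun n => w n + w' n := by
  obtain ⟨N, hN⟩ := h
  obtain ⟨N', hN'⟩ := h'
  exact ⟨N + N', fun n hn => by dsimp only; rw [hN n (by omega), hN' n (by omega), add_zero]⟩

theorem EventuallyZero.map {V' : Type*} [AddCommGroup V'] {w : ℕ → V} (h : EventuallyZero w)
    (φ : ℕ → V → V') (hφ : ∀ n, φ n 0 = 0) : EventuallyZero fun n => φ n (w n) := by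
  obtain ⟨N, hN⟩ := h
  exact ⟨N, fun n hn => by dsimp only; rw [hN n hn, hφ]⟩

theorem EventuallyZero.sub {w w' : ℕ → V} (h : EventuallyZero w) (h' : EventuallyZero w') :
    EventuallyZero fun n => w n - w' n := by
  obtain ⟨N, hN⟩ := h
  obtain ⟨N', hN'⟩ := h'
  exact ⟨N + N', fun n hn => by dsimp only; rw [hN n (by omega), hN' n (by omega), sub_zero]⟩

theorem EventuallyZero.nsmul_pred {w : ℕ → V} (h : EventuallyZero w) :
    EventuallyZero fun n => n • w (n - 1) := by
  obtain ⟨N, hN⟩ := h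
  exact ⟨N + 1, fun n hn => by dsimp only; rw [hN (n - 1) (by omega), smul_zero]⟩

theorem EventuallyZero₂.of_right {w : ℕ → ℕ → V} (h : ∃ M, ∀ m, M ≤ m → ∀ n, w n m = 0)
    (h' : ∀ m, EventuallyZero fun n => w n m) : EventuallyZero₂ w := by
  obtain ⟨M, hM⟩ := h
  choose N hN using h'
  -- Only the columns with index below `M` can be nonzero; the bound exceeds each of their
  -- thresholds.
  refine ⟨M + (Finset.range M).sup N, fun n m hnm => ?_⟩
  rcases le_or_gt M m with hm | hm
  · exact hM m hm n
  · have : N m ≤ (Finset.range M).sup N := Finset.le_sup (Finset.mem_range.2 hm)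
    exact hN m n (by omega)

theorem EventuallyZero₂.swap {w : ℕ → ℕ → V} (h : EventuallyZero₂ w) :
    EventuallyZero₂ fun n m => w m n := by
  obtain ⟨N, hN⟩ := h
  exact ⟨N, fun n m h => hN m n h.symm⟩

theorem EventuallyZero₂.sub {w w' : ℕ → ℕ → V} (h : EventuallyZero₂ w) (h' : EventuallyZero₂ w') :
    EventuallyZero₂ fun n m => w n m - w' n m := by
  obtain ⟨N, hN⟩ := h
  obtain ⟨N', hN'⟩ := h'
  exact ⟨N + N', fun n m hn => by dsimp only; rw [hN n m (by omega), hN' n m (by omega), sub_zero]⟩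

theorem EventuallyZero₂.right {w : ℕ → ℕ → V} (h : EventuallyZero₂ w) (n : ℕ) :
    EventuallyZero (w n) := by
  obtain ⟨N, hN⟩ := h
  exact ⟨N, fun m hm => hN n m (.inr hm)⟩

theorem expSum_zero (p : k[X]) : expSum p (fun _ => (0 : V)) = 0 := by
  simp [expSum]

theorem EventuallyZero₂.expSum {w : ℕ → ℕ → V} (h : EventuallyZero₂ w) (p : k[X]) :
    EventuallyZero fun n => expSum p (w n) := by
  obtain ⟨N, hN⟩ := h
  refine ⟨N, fun n hn => ?_⟩
  dsimp only
  rw [show w n = fun _ => 0 from funext fun m => hN n m (.inl hn), expSum_zero]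

theorem expSum_add {w w' : ℕ → V} (h : EventuallyZero w) (h' : EventuallyZero w') (p : k[X]) :
    expSum p (fun n => w n + w' n) = expSum p w + expSum p w' := by
  obtain ⟨N, hN⟩ := h
  obtain ⟨N', hN'⟩ := h'
  rw [expSum_eq (N := N + N') (fun n hn => by rw [hN n (by omega), hN' n (by omega), add_zero]),
    expSum_eq (N := N + N') (fun n hn => hN n (by omega)),
    expSum_eq (N := N + N') (fun n hn => hN' n (by omega)), ← Finset.sum_add_distrib]
  simp only [smul_add]

/-- The map is only assumed additive, with multiplication by powers of `p` turning into
multiplication by powers of `q`. This covers the sesquilinear maps below, for which `D` changes into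
`D + λ` or `-λ`. -/
theorem expSum_map {V' : Type*} [AddCommGroup V'] [Module k[X] V'] {w : ℕ → V}
    (h : EventuallyZero w) (p q : k[X]) (φ : V →+ V')
    (hφ : ∀ (n : ℕ) (x : V),
      φ ((C ((n.factorial : k)⁻¹) * p ^ n) • x) = (C ((n.factorial : k)⁻¹) * q ^ n) • φ x) :
    φ (expSum p w) = expSum q fun n => φ (w n) := by
  obtain ⟨N, hN⟩ := h
  rw [expSum_eq hN, expSum_eq (N := N) (fun n hn => by rw [hN n hn, map_zero]), map_sum]
  simp only [hφ]

theorem expSum_linearMap {V' : Type*} [AddCommGroup V'] [Module k[X] V'] {w : ℕ → V}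
    (h : EventuallyZero w) (p : k[X]) (φ : V →ₗ[k[X]] V') :
    φ (expSum p w) = expSum p fun n => φ (w n) :=
  expSum_map h p p φ.toAddMonoidHom fun _ _ => φ.map_smul _ _

theorem expSum_smul {w : ℕ → V} (h : EventuallyZero w) (p f : k[X]) :
    expSum p (fun n => f • w n) = f • expSum p w :=
  (expSum_linearMap h p (LinearMap.lsmul k[X] V f)).symm

theorem expSum_neg {w : ℕ → V} (h : EventuallyZero w) (p : k[X]) :
    expSum p (fun n => -w n) = -expSum p w :=
  (expSum_linearMap h p (-LinearMap.id)).symm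

theorem expSum_sub {w w' : ℕ → V} (h : EventuallyZero w) (h' : EventuallyZero w') (p : k[X]) :
    expSum p (fun n => w n - w' n) = expSum p w - expSum p w' := by
  simp only [sub_eq_add_neg]
  rw [expSum_add h (h'.map (fun _ x => -x) fun _ => neg_zero), expSum_neg h']

theorem expSum_mem {S : Submodule k[X] V} {w : ℕ → V} (h : EventuallyZero w) (hS : ∀ n, w n ∈ S)
    (p : k[X]) : expSum p w ∈ S := by
  obtain ⟨N, hN⟩ := h
  rw [expSum_eq hN]
  exact S.sum_mem fun n _ => S.smul_mem _ (hS n)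

theorem expSum_comm {w : ℕ → ℕ → V} (h : EventuallyZero₂ w) (p q : k[X]) :
    expSum p (fun n => expSum q (w n)) = expSum q fun m => expSum p fun n => w n m := by
  obtain ⟨N, hN⟩ := h
  have h1 : ∀ n, expSum q (w n) = ∑ m ∈ Finset.range N, (C ((m.factorial : k)⁻¹) * q ^ m) • w n m :=
    fun n => expSum_eq (fun m hm => hN n m (.inr hm)) q
  have h2 : ∀ m, expSum p (fun n => w n m) =
      ∑ n ∈ Finset.range N, (C ((n.factorial : k)⁻¹) * p ^ n) • w n m :=
    fun m => expSum_eq (fun n hn => hN n m (.inl hn)) p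
  rw [expSum_eq (N := N) (fun n hn => by
      rw [show w n = fun _ => 0 from funext fun m => hN n m (.inl hn), expSum_zero]),
    expSum_eq (N := N) (fun m hm => by
      rw [show (fun n => w n m) = fun _ => 0 from funext fun n => hN n m (.inr hm), expSum_zero])]
  simp only [h1, h2, Finset.smul_sum]
  rw [Finset.sum_comm]
  exact Finset.sum_congr rfl fun m _ => Finset.sum_congr rfl fun n _ => smul_comm _ _ _

theorem EventuallyZero₂.sum_choose {w : ℕ → ℕ → V} (hw : EventuallyZero₂ w) :
    EventuallyZero₂ fun n m => ∑ s ∈ Finset.range (n + 1), n.choose s • w (n - s) (m + s) := by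
  obtain ⟨N, hN⟩ := hw
  refine ⟨N + N, fun n m h => Finset.sum_eq_zero fun s hs => ?_⟩
  rw [Finset.mem_range] at hs
  rw [hN _ _ (by omega), smul_zero]

theorem EventuallyZero₂.add {w w' : ℕ → ℕ → V} (h : EventuallyZero₂ w) (h' : EventuallyZero₂ w') :
    EventuallyZero₂ fun n m => w n m + w' n m := by
  obtain ⟨N, hN⟩ := h
  obtain ⟨N', hN'⟩ := h'
  exact ⟨N + N', fun n m hn => by
    dsimp only; rw [hN n m (by omega), hN' n m (by omega), add_zero]⟩

theorem expSum_expSum_add {w w' : ℕ → ℕ → V} (h : EventuallyZero₂ w) (h' : EventuallyZero₂ w')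
    (p q : k[X]) : expSum p (fun n => expSum q fun m => w n m + w' n m) =
      expSum p (fun n => expSum q (w n)) + expSum p fun n => expSum q (w' n) := by
  simp only [fun n => expSum_add (h.right n) (h'.right n) q]
  exact expSum_add (h.expSum q) (h'.expSum q) p

theorem expSum_expSum_sub {w w' : ℕ → ℕ → V} (h : EventuallyZero₂ w) (h' : EventuallyZero₂ w')
    (p q : k[X]) : expSum p (fun n => expSum q fun m => w n m - w' n m) =
      expSum p (fun n => expSum q (w n)) - expSum p fun n => expSum q (w' n) := by
  simp only [fun n => expSum_sub (h.right n) (h'.right n) q]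
  exact expSum_sub (h.expSum q) (h'.expSum q) p

variable [CharZero k]

theorem expSum_nsmul_pred {w : ℕ → V} (h : EventuallyZero w) (p : k[X]) :
    expSum p (fun n => n • w (n - 1)) = p • expSum p w := by
  obtain ⟨N, hN⟩ := h
  rw [expSum_eq hN,
    expSum_eq (N := N + 1) (fun n hn => by rw [hN (n - 1) (by omega), smul_zero]),
    Finset.sum_range_succ', Finset.smul_sum]
  simp only [zero_smul, smul_zero, add_zero, Nat.add_sub_cancel]
  refine Finset.sum_congr rfl fun n _ => ?_
  rw [← Nat.cast_smul_eq_nsmul k[X], smul_smul, smul_smul]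
  congr 1
  have : C (((n + 1).factorial : k)⁻¹) * ((n + 1 : ℕ) : k[X]) = C ((n.factorial : k)⁻¹) := by
    rw [← C_eq_natCast, ← C_mul, Nat.factorial_succ, Nat.cast_mul, mul_inv]
    congr 1
    field_simp
  rw [← this]
  ring

/-- A polynomial with coefficients in a module is recovered from its values at the distinct points
`0, …, N - 1` of a field of characteristic zero, by inverting a Vandermonde matrix. Hence a formal
`λ` is never needed: identities for all scalars `r` give those for every `n`. -/
theorem mem_of_expSum_mem (S : Submodule k[X] V) {w : ℕ → V} (hw : EventuallyZero w)
    (h : ∀ r : k, expSum (C r) w ∈ S) (n : ℕ) : w n ∈ S := by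
  obtain ⟨N, hN⟩ := hw
  rcases le_or_gt N n with hn | hn
  · rw [hN n hn]; exact S.zero_mem
  let v : Fin N → k := fun i => (i : ℕ)
  let M := Matrix.vandermonde v
  have hM : IsUnit M.det := by
    refine isUnit_iff_ne_zero.2 (Matrix.det_vandermonde_ne_zero_iff.2 fun i j hij => ?_)
    exact Fin.ext (Nat.cast_injective hij)
  have key : ∑ j, C (M⁻¹ ⟨n, hn⟩ j) • expSum (C (v j)) w = C ((n.factorial : k)⁻¹) • w n := by
    have h1 : ∀ j, C (M⁻¹ ⟨n, hn⟩ j) • expSum (C (v j)) w =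
        ∑ m : Fin N, C (M⁻¹ ⟨n, hn⟩ j * M j m) • C (((m : ℕ).factorial : k)⁻¹) • w m := by
      intro j
      rw [expSum_eq hN, Finset.sum_range, Finset.smul_sum]
      refine Finset.sum_congr rfl fun m _ => ?_
      rw [smul_smul, smul_smul]
      congr 1
      simp only [M, Matrix.vandermonde_apply, C_mul, C_pow]
      ring
    simp only [h1]
    rw [Finset.sum_comm]
    simp only [← Finset.sum_smul, ← map_sum, ← Matrix.mul_apply, Matrix.nonsing_inv_mul M hM]
    rw [Finset.sum_eq_single ⟨n, hn⟩]
    · simp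
    · intro m _ hm
      rw [Matrix.one_apply_ne hm.symm, C_0, zero_smul]
    · simp
  have h2 : C ((n.factorial : k)⁻¹) • w n ∈ S :=
    key ▸ S.sum_mem fun j _ => S.smul_mem _ (h _)
  have h3 := S.smul_mem (C (n.factorial : k)) h2
  rwa [smul_smul, ← C_mul, mul_inv_cancel₀ (Nat.cast_ne_zero.2 n.factorial_ne_zero), C_1,
    one_smul] at h3

theorem eq_of_expSum_eq {w w' : ℕ → V} (hw : EventuallyZero w) (hw' : EventuallyZero w')
    (h : ∀ r : k, expSum (C r) w = expSum (C r) w') (n : ℕ) : w n = w' n := by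
  have := mem_of_expSum_mem (⊥ : Submodule k[X] V) (hw.sub hw')
    (fun r => by rw [expSum_sub hw hw', h, sub_self]; exact zero_mem _) n
  exact sub_eq_zero.1 ((Submodule.mem_bot _).1 this)

theorem mem_of_expSum_expSum_mem (S : Submodule k[X] V) {w : ℕ → ℕ → V} (hw : EventuallyZero₂ w)
    (h : ∀ r s : k, expSum (C r) (fun n => expSum (C s) (w n)) ∈ S) (n m : ℕ) : w n m ∈ S :=
  mem_of_expSum_mem S (hw.right n)
    (fun s => mem_of_expSum_mem S (hw.expSum (C s)) (fun r => h r s) n) m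

theorem eq_of_expSum_expSum_eq {w w' : ℕ → ℕ → V} (hw : EventuallyZero₂ w)
    (hw' : EventuallyZero₂ w')
    (h : ∀ r s : k, expSum (C r) (fun n => expSum (C s) (w n)) =
      expSum (C r) (fun n => expSum (C s) (w' n))) (n m : ℕ) : w n m = w' n m :=
  eq_of_expSum_eq (hw.right n) (hw'.right n)
    (fun s => eq_of_expSum_eq (hw.expSum (C s)) (hw'.expSum (C s)) (fun r => h r s) n) m

/-- The binomial sums in the associativity, Jacobi and cocycle identities are the coefficients
obtained on expanding the powers of `λ + μ`. With this lemma those identities take their usual form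
in `λ` and `μ`. -/
theorem expSum_expSum_sum_choose {w : ℕ → ℕ → V} (hw : EventuallyZero₂ w) (p q : k[X]) :
    expSum p (fun n => expSum q fun m =>
      ∑ s ∈ Finset.range (n + 1), n.choose s • w (n - s) (m + s)) =
    expSum p fun n => expSum (p + q) (w n) := by
  obtain ⟨N, hN⟩ := hw
  have h1 : ∀ n, expSum (p + q) (w n) = ∑ m ∈ Finset.range N,
      (C ((m.factorial : k)⁻¹) * (p + q) ^ m) • w n m :=
    fun n => expSum_eq (fun m hm => hN n m (.inr hm)) _
  have h2 : ∀ n, expSum q (fun m => ∑ s ∈ Finset.range (n + 1), n.choose s • w (n - s) (m + s)) =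
      ∑ m ∈ Finset.range N, (C ((m.factorial : k)⁻¹) * q ^ m) •
        ∑ s ∈ Finset.range (n + 1), n.choose s • w (n - s) (m + s) :=
    fun n => expSum_eq (fun m hm => Finset.sum_eq_zero fun s hs => by
      rw [hN _ _ (.inr (by omega)), smul_zero]) _
  rw [expSum_eq (N := N) (w := fun n => expSum (p + q) (w n)) (fun n hn => by
      rw [show w n = fun _ => 0 from funext fun m => hN n m (.inl hn), expSum_zero]),
    expSum_eq (N := N + N) (fun n hn => by
      rw [h2]; refine Finset.sum_eq_zero fun m hm => ?_
      rw [Finset.sum_eq_zero, smul_zero]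
      intro s hs
      rw [Finset.mem_range] at hs
      rw [hN _ _ (by omega), smul_zero])]
  simp only [h1, h2, Finset.smul_sum, add_pow, Finset.mul_sum, Finset.sum_smul]
  simp only [Finset.sum_sigma']
  symm
  -- The term `pˢ q^(j-s)` of `(p + q)ʲ`, multiplied by `pⁱ`, belongs to `n = i + s` and `m = j -
  -- s`. Terms outside the image of this reindexing vanish.
  refine Finset.sum_of_injOn (fun x : (Σ _ : ℕ, Σ _ : ℕ, ℕ) =>
    (⟨x.1 + x.2.2, x.2.1 - x.2.2, x.2.2⟩ : Σ _ : ℕ, Σ _ : ℕ, ℕ)) ?_ ?_ ?_ ?_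
  · rintro ⟨i, j, s⟩ h ⟨i', j', s'⟩ h' heq
    simp only [Finset.coe_sigma, Set.mem_sigma_iff, Finset.mem_coe, Finset.mem_range,
      Sigma.mk.injEq, heq_eq_eq] at h h' heq ⊢
    omega
  · rintro ⟨i, j, s⟩ h
    simp only [Finset.coe_sigma, Set.mem_sigma_iff, Finset.mem_coe, Finset.mem_range] at h ⊢
    omega
  · rintro ⟨n, m, s⟩ h h'
    simp only [Finset.mem_sigma, Finset.mem_range] at h
    dsimp only
    rw [hN _ _ ?_, smul_zero, smul_zero, smul_zero]
    by_contra hcon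
    refine h' ⟨⟨n - s, m + s, s⟩, ?_, ?_⟩
    · simp only [Finset.coe_sigma, Set.mem_sigma_iff, Finset.mem_coe, Finset.mem_range]
      omega
    · simp only [Sigma.mk.injEq, heq_eq_eq]
      exact ⟨by omega, by omega, trivial⟩
  · rintro ⟨i, j, s⟩ h
    simp only [Finset.mem_sigma, Finset.mem_range] at h
    obtain ⟨t, rfl⟩ : ∃ t, j = t + s := ⟨j - s, by omega⟩
    simp only [Nat.add_sub_cancel]
    rw [← Nat.cast_smul_eq_nsmul k[X], smul_smul, smul_smul, smul_smul]
    congr 1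
    have key : ∀ a : ℕ, C (((a + s).factorial : k)⁻¹) * (((a + s).choose s : ℕ) : k[X]) =
        C ((a.factorial : k)⁻¹) * C ((s.factorial : k)⁻¹) := by
      intro a
      rw [← C_eq_natCast, ← C_mul, ← C_mul, ← Nat.add_choose_mul_factorial_mul_factorial a s]
      have h1 : ((a + s).choose s : k) ≠ 0 :=
        Nat.cast_ne_zero.2 (Nat.choose_pos (Nat.le_add_left _ _)).ne'
      have h2 : (a.factorial : k) ≠ 0 := Nat.cast_ne_zero.2 a.factorial_ne_zero
      have h3 : (s.factorial : k) ≠ 0 := Nat.cast_ne_zero.2 s.factorial_ne_zero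
      push_cast
      congr 1
      field_simp
    -- Both coefficients equal `1 / (i! t! s!)`.
    linear_combination (C ((i.factorial : k)⁻¹) * p ^ i * p ^ s * q ^ t) * key t -
      (C ((t.factorial : k)⁻¹) * p ^ i * p ^ s * q ^ t) * key i

end ExpSum

/-! ## Products with a parameter -/

section LamProd

variable {k : Type*} [Field k] {A : Type*} [AddCommGroup A] [Module k[X] A] [NProducts A]

/-- `∑ pⁿ / n! • (a ∘ₙ b)`. -/
noncomputable def lamProd (p : k[X]) (a b : A) : A := expSum p fun n => nprod n a b

theorem braceProd_eq {a b : A} {N : ℕ} (hN : ∀ n, N ≤ n → nprod n a b = 0) (n : ℕ) :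
    braceProd k n a b = ∑ s ∈ Finset.range N,
      (C ((-1 : k) ^ (n + s) / (s.factorial : k)) * X ^ s : k[X]) • nprod (n + s) a b := by
  refine finsum_eq_sum_of_support_subset _ fun s hs => ?_
  rw [Finset.coe_range, Set.mem_Iio]
  by_contra h
  exact hs (by dsimp only; rw [hN (n + s) (by omega), smul_zero])

variable [IsConformalAlgebra k A]

theorem eventuallyZero_nprod (k : Type*) [Field k] {A : Type*} [AddCommGroup A] [Module k[X] A]
    [NProducts A] [IsConformalAlgebra k A] (a b : A) : EventuallyZero fun n => nprod n a b :=
  IsConformalAlgebra.locality k a b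

variable (k) in
/-- The `n`-product with a fixed left factor. -/
def nprodLeft (n : ℕ) (a : A) : A →+ A :=
  AddMonoidHom.mk' (nprod n a) (IsConformalAlgebra.nprod_add k n a)

theorem lamProd_add (p : k[X]) (a b b' : A) :
    lamProd p a (b + b') = lamProd p a b + lamProd p a b' := by
  simp only [lamProd, IsConformalAlgebra.nprod_add k]
  exact expSum_add (eventuallyZero_nprod k a b) (eventuallyZero_nprod k a b') p

theorem add_lamProd (p : k[X]) (a a' b : A) :
    lamProd p (a + a') b = lamProd p a b + lamProd p a' b := by
  simp only [lamProd, IsConformalAlgebra.add_nprod k]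
  exact expSum_add (eventuallyZero_nprod k a b) (eventuallyZero_nprod k a' b) p

/-- `lamProd` with a fixed left factor. -/
noncomputable def lamLeft (p : k[X]) (a : A) : A →+ A :=
  AddMonoidHom.mk' (lamProd p a) (lamProd_add p a)

/-- `lamProd` with a fixed right factor. -/
noncomputable def lamRight (p : k[X]) (b : A) : A →+ A :=
  AddMonoidHom.mk' (fun a => lamProd p a b) fun a a' => add_lamProd p a a' b

theorem lamProd_sub (p : k[X]) (a b b' : A) :
    lamProd p a (b - b') = lamProd p a b - lamProd p a b' := (lamLeft p a).map_sub b b'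

theorem sub_lamProd (p : k[X]) (a a' b : A) :
    lamProd p (a - a') b = lamProd p a b - lamProd p a' b := (lamRight p b).map_sub a a'

theorem lamProd_C_smul (p : k[X]) (r : k) (a b : A) :
    lamProd p a ((C r : k[X]) • b) = (C r : k[X]) • lamProd p a b := by
  simp only [lamProd, IsConformalAlgebra.nprod_smul]
  exact expSum_smul (eventuallyZero_nprod k a b) p _

theorem C_smul_lamProd (p : k[X]) (r : k) (a b : A) :
    lamProd p ((C r : k[X]) • a) b = (C r : k[X]) • lamProd p a b := by
  simp only [lamProd, IsConformalAlgebra.smul_nprod]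
  exact expSum_smul (eventuallyZero_nprod k a b) p _

/-- A single `n`-product is linear over `k` but not over `H`, whence the scalar parameter. -/
theorem nprod_expSum_C {w : ℕ → A} (hw : EventuallyZero w) (n : ℕ) (r : k) (a : A) :
    nprod n a (expSum (C r) w) = expSum (C r) fun m => nprod n a (w m) :=
  expSum_map hw _ _ (nprodLeft k n a) fun m x => by
    change nprod n a _ = _ • nprod n a x
    rw [← C_pow, ← C_mul, IsConformalAlgebra.nprod_smul]

theorem eventuallyZero_braceProd (a b : A) : EventuallyZero fun n => braceProd k n a b := by
  obtain ⟨N, hN⟩ := eventuallyZero_nprod k a b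
  refine ⟨N, fun n hn => finsum_eq_zero_of_forall_eq_zero fun s => ?_⟩
  have := hN (n + s) (by omega)
  dsimp only at this
  rw [this, smul_zero]

/-- The commutator `a_λ b - b_{-λ-D} a`. -/
noncomputable def lamBracket (r : k) (a b : A) : A := lamProd (C r) a b - lamProd (-C r - X) b a

theorem expSum_lamBracket (r s : k) {w : ℕ → A} (hw : EventuallyZero w) (c : A) :
    lamBracket s (expSum (C r) w) c = expSum (C r) fun n => lamBracket s (w n) c := by
  refine expSum_map hw _ _ (AddMonoidHom.mk' (fun a => lamBracket s a c) fun a b => ?_) ?_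
  · simp only [lamBracket, add_lamProd, lamProd_add]
    abel
  · intro n x
    change lamBracket s _ c = _ • lamBracket s x c
    rw [← C_pow, ← C_mul]
    simp only [lamBracket, C_smul_lamProd, lamProd_C_smul, smul_sub]

variable [CharZero k]

theorem X_smul_lamProd (p : k[X]) (a b : A) :
    lamProd p ((X : k[X]) • a) b = -p • lamProd p a b := by
  simp only [lamProd, IsConformalAlgebra.D_nprod]
  rw [expSum_neg (eventuallyZero_nprod k a b).nsmul_pred,
    expSum_nsmul_pred (eventuallyZero_nprod k a b), neg_smul]

theorem lamProd_X_smul (p : k[X]) (a b : A) :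
    lamProd p a ((X : k[X]) • b) = (X + p) • lamProd p a b := by
  simp only [lamProd, IsConformalAlgebra.nprod_D]
  have h := eventuallyZero_nprod k a b
  rw [expSum_add (h.map (fun _ x => (X : k[X]) • x) fun _ => smul_zero _) h.nsmul_pred,
    expSum_nsmul_pred h, expSum_smul h, add_smul]

/-- Sesquilinearity in the left factor, where `D` acts as `-λ`; in the right factor it acts as `D +
λ`. The parameter may itself involve `D`, as in `b_{-λ-D} a`. -/
theorem smul_lamProd (p f : k[X]) (a b : A) :
    lamProd p (f • a) b = f.comp (-p) • lamProd p a b := by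
  induction f using Polynomial.induction_on generalizing a with
  | C r => rw [C_smul_lamProd, C_comp]
  | add f g hf hg => rw [add_smul, add_lamProd, hf, hg, add_comp, add_smul]
  | monomial i r ih =>
    rw [pow_succ, ← mul_assoc, mul_smul, ih, X_smul_lamProd, smul_smul,
      mul_comp (C r * X ^ i) X, X_comp]

theorem lamProd_smul (p f : k[X]) (a b : A) :
    lamProd p a (f • b) = f.comp (X + p) • lamProd p a b := by
  induction f using Polynomial.induction_on generalizing b with
  | C r => rw [lamProd_C_smul, C_comp]
  | add f g hf hg => rw [add_smul, lamProd_add, hf, hg, add_comp, add_smul]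
  | monomial i r ih =>
    rw [pow_succ, ← mul_assoc, mul_smul, ih, lamProd_X_smul, smul_smul,
      mul_comp (C r * X ^ i) X, X_comp]

theorem lamProd_expSum {w : ℕ → A} (hw : EventuallyZero w) (p q : k[X]) (a : A) :
    lamProd p a (expSum q w) = expSum (q.comp (X + p)) fun n => lamProd p a (w n) :=
  expSum_map hw q (q.comp (X + p)) (lamLeft p a) fun n x => by
    change lamProd p a _ = _ • lamProd p a x
    rw [lamProd_smul, mul_comp, C_comp, pow_comp]

theorem expSum_lamProd {w : ℕ → A} (hw : EventuallyZero w) (p q : k[X]) (b : A) :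
    lamProd p (expSum q w) b = expSum (q.comp (-p)) fun n => lamProd p (w n) b :=
  expSum_map hw q (q.comp (-p)) (lamRight p b) fun n x => by
    change lamProd p _ b = _ • lamProd p x b
    rw [smul_lamProd, mul_comp, C_comp, pow_comp]

/-- The braces are designed to be the coefficients of `a_{-λ-D} b`: this is the expansion of
`(-λ-D)ʲ` by the binomial formula. -/
theorem expSum_braceProd (p : k[X]) (a b : A) :
    expSum p (fun n => braceProd k n a b) = lamProd (-p - X) a b := by
  have h := eventuallyZero_nprod k a b
  -- Concentrating the double sequence in the row `i = 0` leaves only the term `s = n` of the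
  -- binomial sum, so that the general lemma with `q = D` becomes the expansion of powers of `p +
  -- D`.
  have hw : EventuallyZero₂ fun i j : ℕ =>
      if i = 0 then (C ((-1 : k) ^ j) : k[X]) • nprod j a b else 0 := by
    obtain ⟨N, hN⟩ := h
    refine ⟨N + 1, fun n m h => ?_⟩
    dsimp only at hN ⊢
    split_ifs with h0
    · rw [hN m (by omega), smul_zero]
    · rfl
  have h1 := expSum_expSum_sum_choose hw p X
  have h2 : ∀ n m : ℕ, (∑ s ∈ Finset.range (n + 1), n.choose s •
      if n - s = 0 then (C ((-1 : k) ^ (m + s)) : k[X]) • nprod (m + s) a b else 0) =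
      (C ((-1 : k) ^ (n + m)) : k[X]) • nprod (n + m) a b := by
    intro n m
    rw [Finset.sum_range_succ, Finset.sum_eq_zero, Nat.choose_self, one_smul, Nat.sub_self,
      if_pos rfl, zero_add, add_comm]
    intro s hs
    rw [Finset.mem_range] at hs
    rw [if_neg (by omega), smul_zero]
  simp only [h2] at h1
  have h3 : ∀ n, braceProd k n a b =
      expSum (X : k[X]) fun m => (C ((-1 : k) ^ (n + m)) : k[X]) • nprod (n + m) a b := by
    intro n
    refine finsum_congr fun s => ?_
    dsimp only
    rw [smul_smul, div_eq_mul_inv, C_mul]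
    congr 1
    ring
  simp only [h3, h1]
  rw [expSum_eq (N := 1) (fun n hn => by
    simp only [if_neg (show n ≠ 0 by omega)]
    exact expSum_zero _)]
  simp only [Finset.range_one, Finset.sum_singleton, Nat.factorial_zero, Nat.cast_one, inv_one, C_1,
    pow_zero, mul_one, one_smul, if_true]
  rw [lamProd, expSum, expSum]
  refine finsum_congr fun n => ?_
  rw [smul_smul, show -p - (X : k[X]) = C (-1) * (p + X) by rw [C_neg, C_1]; ring, mul_pow, C_pow]
  congr 1
  ring

end LamProd

/-! ### Associativity and commutators in terms of the parameter -/

section Assoc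

theorem eventuallyZero₂_nprod_left (k : Type*) [Field k] {A : Type*} [AddCommGroup A]
    [Module k[X] A] [NProducts A] [IsConformalAlgebra k A] (a b c : A) :
    EventuallyZero₂ fun n m => nprod m (nprod n a b) c := by
  refine EventuallyZero₂.swap (EventuallyZero₂.of_right (w := fun m n => nprod m (nprod n a b) c)
    ?_ fun n => eventuallyZero_nprod k _ c)
  obtain ⟨N, hN⟩ := eventuallyZero_nprod k a b
  exact ⟨N, fun n hn m => by
    have := hN n hn
    dsimp only at this
    rw [this, zero_nprod (k := k)]⟩

theorem eventuallyZero₂_nprod_right (k : Type*) [Field k] {A : Type*} [AddCommGroup A]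
    [Module k[X] A] [NProducts A] [IsConformalAlgebra k A] (a b c : A) :
    EventuallyZero₂ fun n m => nprod n a (nprod m b c) := by
  refine EventuallyZero₂.of_right ?_ fun n => eventuallyZero_nprod k a _
  obtain ⟨N, hN⟩ := eventuallyZero_nprod k b c
  exact ⟨N, fun n hn m => by
    have := hN n hn
    dsimp only at this
    rw [this, nprod_zero (k := k)]⟩

variable {k : Type*} [Field k] [CharZero k] {A : Type*} [AddCommGroup A] [Module k[X] A]
  [NProducts A] [IsAssocConformalAlgebra k A]

theorem expSum_expSum_nprod (p q : k[X]) (a b c : A) :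
    expSum p (fun n => expSum q fun m => nprod n a (nprod m b c)) =
      expSum p fun n => lamProd (p + q) (nprod n a b) c := by
  simp only [IsAssocConformalAlgebra.assoc k]
  exact expSum_expSum_sum_choose (eventuallyZero₂_nprod_left k a b c) p q

/-- For constant `q` this is `a_λ (b_μ c) = (a_λ b)_{λ+μ} c`. For general `q` the powers of `D` in
it become powers of `D + r` on passing through the left multiplication. -/
theorem lamProd_lamProd (r : k) (q : k[X]) (a b c : A) :
    lamProd (C r) a (lamProd q b c) =
      lamProd (C r + q.comp (X + C r)) (lamProd (C r) a b) c := by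
  rw [lamProd.eq_1 q, lamProd_expSum (eventuallyZero_nprod k b c)]
  simp only [lamProd.eq_1 (C r) a]
  rw [expSum_comm (EventuallyZero₂.swap (eventuallyZero₂_nprod_right k a b c)), expSum_expSum_nprod,
    expSum_lamProd (eventuallyZero_nprod k a b), C_comp]

/-- Left and right multiplications commute. -/
theorem lamProd_lamProd_sub_X (r s : k) (a b c : A) :
    lamProd (C r) a (lamProd (-C s - X) b c) = lamProd (-C s - X) (lamProd (C r) a b) c := by
  rw [lamProd_lamProd]
  congr 1
  simp
  ring

/-- Associativity for two successive right multiplications: in the left factor of the outer product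
`D` acts as `r + D`, which turns the inner parameter `-s - D` into `-(r + s) - D`. -/
theorem lamProd_sub_X_lamProd_sub_X (r s : k) (a b c : A) :
    lamProd (-C r - X) (lamProd (-C s - X) a b) c =
      lamProd (-C (r + s) - X) a (lamProd (C s) b c) := by
  have h := eventuallyZero_nprod k a b
  have h1 := expSum_expSum_nprod (-C (r + s) - X) (C s) a b c
  simp only [← nprod_expSum_C (eventuallyZero_nprod k b c)] at h1
  rw [lamProd.eq_1 _ a, lamProd.eq_1 _ a, lamProd.eq_1 _ b, h1, expSum_lamProd h]
  congr 1
  · simp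
    ring
  · ext n
    congr 1
    simp
    ring

/-- On the left factor of a product with parameter `r + s`, the operator `D` is the scalar `-(r +
s)`, so `-r - D` becomes `s`. -/
theorem lamProd_add_lamProd_sub_X (r s : k) (a b c : A) :
    lamProd (C (r + s)) (lamProd (-C r - X) a b) c =
      lamProd (C (r + s)) (lamProd (C s) a b) c := by
  have h := eventuallyZero_nprod k a b
  rw [lamProd.eq_1 _ a, lamProd.eq_1 _ a, expSum_lamProd h, expSum_lamProd h]
  congr 1
  simp

/-- In the right factor `D` becomes `D + (-(r + s) - D) = -(r + s)`, so again `-r - D` becomes `s`.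
-/
theorem lamProd_sub_X_lamProd_sub_X' (r s : k) (a b c : A) :
    lamProd (-C (r + s) - X) a (lamProd (-C r - X) b c) =
      lamProd (-C (r + s) - X) a (lamProd (C s) b c) := by
  have h := eventuallyZero_nprod k b c
  rw [lamProd.eq_1 _ b, lamProd.eq_1 _ b, lamProd_expSum h, lamProd_expSum h]
  congr 1
  simp

/-- The Leibniz rule, which follows from associativity as in an ordinary algebra: the term with `a`
between `b` and `c` is subtracted in the first summand and added in the second. -/
theorem lamBracket_lamProd (r s : k) (a b c : A) :
    lamBracket r a (lamProd (C s) b c) =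
      lamProd (C (r + s)) (lamBracket r a b) c + lamProd (C s) b (lamBracket r a c) := by
  have h1 := lamProd_lamProd r (C s) a b c
  have h2 := lamProd_lamProd_sub_X s r b c a
  have h3 := lamProd_add_lamProd_sub_X r s b a c
  have h4 := lamProd_lamProd s (C r) b a c
  rw [C_comp, ← C_add] at h1 h4
  rw [add_comm s r] at h4
  simp only [lamBracket, sub_lamProd, lamProd_sub]
  rw [h1, ← h2, h3, h4]
  abel

/-- Left multiplication, multiplied by the parameter, is a cocycle with respect to commutators. -/
theorem smul_lamBracket_lamProd_add (r s : k) (a b c : A) :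
    (C s : k[X]) • lamBracket r a (lamProd (C s) b c) +
        (C r : k[X]) • lamProd (C r) a (lamBracket s b c) -
      ((C r : k[X]) • lamBracket s b (lamProd (C r) a c) +
        (C s : k[X]) • lamProd (C s) b (lamBracket r a c)) =
      (C (r + s) : k[X]) • lamProd (C (r + s)) (lamBracket r a b) c := by
  have h1 := lamBracket_lamProd r s a b c
  have h2 := lamBracket_lamProd s r b a c
  have h3 := lamProd_add_lamProd_sub_X r s b a c
  have h4 := lamProd_add_lamProd_sub_X s r a b c
  rw [add_comm s r] at h2 h4
  -- Skew-symmetry of the commutator, as seen through a left multiplication with parameter `r + s`.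
  -- After the Leibniz rule only `s [a_r b]_{r+s} c - r [b_s a]_{r+s} c` is left, and the sign adds
  -- the two weights up to `r + s`.
  have h5 : lamProd (C (r + s)) (lamBracket s b a) c =
      -lamProd (C (r + s)) (lamBracket r a b) c := by
    simp only [lamBracket, sub_lamProd]
    rw [h3, h4, neg_sub]
  rw [h1, h2, h5, C_add]
  simp only [add_smul, smul_add, smul_neg]
  abel

/-- The ordinary proof of the Jacobi identity: each double commutator expands into four triple
products, which associativity brings to a common form. -/
theorem lamBracket_lamBracket (r s : k) (a b c : A) :
    lamBracket r a (lamBracket s b c) - lamBracket s b (lamBracket r a c) =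
      lamBracket (r + s) (lamBracket r a b) c := by
  have h1 := lamProd_lamProd r (C s) a b c
  have h2 := lamProd_lamProd s (C r) b a c
  have h3 := lamProd_lamProd_sub_X s r b c a
  have h4 := lamProd_lamProd_sub_X r s a c b
  have h5 := lamProd_sub_X_lamProd_sub_X r s c b a
  have h6 := lamProd_sub_X_lamProd_sub_X s r c a b
  have h7 := lamProd_add_lamProd_sub_X r s b a c
  have h8 := lamProd_sub_X_lamProd_sub_X' r s c b a
  rw [C_comp, ← C_add] at h1 h2
  rw [add_comm s r] at h2 h6
  simp only [lamBracket, sub_lamProd, lamProd_sub]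
  rw [h1, h2, h3, h4, h5, h6, h7, h8]
  abel

end Assoc

/-! ## Commutators -/

section Commutator

variable {k : Type*} [Field k] {A : Type*} [AddCommGroup A] [Module k[X] A] [NProducts A]

variable (k) in
/-- The commutator `a ∘ₙ b - {b ∘ₙ a}`. -/
noncomputable def commProd (n : ℕ) (a b : A) : A := nprod n a b - braceProd k n b a

variable [IsConformalAlgebra k A]

variable (k) in
theorem eventuallyZero_commProd (a b : A) : EventuallyZero fun n => commProd k n a b :=
  (eventuallyZero_nprod k a b).sub (eventuallyZero_braceProd b a)

variable [CharZero k]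

theorem expSum_commProd (r : k) (a b : A) :
    expSum (C r) (fun n => commProd k n a b) = lamBracket r a b := by
  simp only [commProd]
  rw [expSum_sub (eventuallyZero_nprod k a b) (eventuallyZero_braceProd b a), expSum_braceProd]
  rfl

/-- Here and below, identities for the braces in every index `n` are checked on generating
functions, where the infinite sum in the definition has disappeared. -/
theorem commProd_add (n : ℕ) (a b c : A) :
    commProd k n a (b + c) = commProd k n a b + commProd k n a c := by
  have h := eventuallyZero_commProd k a
  refine eq_of_expSum_eq (k := k) (h _) ((h b).add (h c)) (fun r => ?_) n
  rw [expSum_add (h b) (h c)]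
  simp only [expSum_commProd, lamBracket, add_lamProd, lamProd_add]
  abel

theorem add_commProd (n : ℕ) (a b c : A) :
    commProd k n (a + b) c = commProd k n a c + commProd k n b c := by
  have h := fun a => eventuallyZero_commProd k a c
  refine eq_of_expSum_eq (k := k) (h _) ((h a).add (h b)) (fun r => ?_) n
  rw [expSum_add (h a) (h b)]
  simp only [expSum_commProd, lamBracket, add_lamProd, lamProd_add]
  abel

theorem commProd_C_smul (n : ℕ) (r : k) (a b : A) :
    commProd k n a ((C r : k[X]) • b) = (C r : k[X]) • commProd k n a b := by
  have h := eventuallyZero_commProd k a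
  refine eq_of_expSum_eq (k := k) (h _) ((h b).map (fun _ x => (C r : k[X]) • x) fun _ => smul_zero _)
    (fun t => ?_) n
  rw [expSum_smul (h b)]
  simp only [expSum_commProd, lamBracket, C_smul_lamProd, lamProd_C_smul, smul_sub]

theorem C_smul_commProd (n : ℕ) (r : k) (a b : A) :
    commProd k n ((C r : k[X]) • a) b = (C r : k[X]) • commProd k n a b := by
  have h := fun a => eventuallyZero_commProd k a b
  refine eq_of_expSum_eq (k := k) (h _) ((h a).map (fun _ x => (C r : k[X]) • x) fun _ => smul_zero _)
    (fun t => ?_) n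
  rw [expSum_smul (h a)]
  simp only [expSum_commProd, lamBracket, C_smul_lamProd, lamProd_C_smul, smul_sub]

theorem commProd_X_smul (n : ℕ) (a b : A) :
    commProd k n a ((X : k[X]) • b) =
      (X : k[X]) • commProd k n a b + n • commProd k (n - 1) a b := by
  have h := eventuallyZero_commProd k a
  have h1 := (h b).map (fun _ x => (X : k[X]) • x) fun _ => smul_zero _
  refine eq_of_expSum_eq (k := k) (h _) (h1.add (h b).nsmul_pred) (fun t => ?_) n
  rw [expSum_add h1 (h b).nsmul_pred, expSum_smul (h b), expSum_nsmul_pred (h b)]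
  simp only [expSum_commProd, lamBracket, X_smul_lamProd, lamProd_X_smul, smul_sub]
  module

theorem X_smul_commProd (n : ℕ) (a b : A) :
    commProd k n ((X : k[X]) • a) b = -(n • commProd k (n - 1) a b) := by
  have h := fun a => eventuallyZero_commProd k a b
  refine eq_of_expSum_eq (k := k) (h _) ((h a).nsmul_pred.map (fun _ x => -x) fun _ => neg_zero)
    (fun t => ?_) n
  rw [expSum_neg (h a).nsmul_pred, expSum_nsmul_pred (h a)]
  simp only [expSum_commProd, lamBracket, X_smul_lamProd, lamProd_X_smul, smul_sub]
  module

variable (k) in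
/-- The commutator with a fixed left factor. -/
noncomputable def commLeft (n : ℕ) (a : A) : A →+ A :=
  AddMonoidHom.mk' (commProd k n a) (commProd_add n a)

theorem commProd_zero (n : ℕ) (a : A) : commProd k n a 0 = 0 := (commLeft k n a).map_zero

theorem zero_commProd (n : ℕ) (a : A) : commProd k n 0 a = 0 := by
  simpa using add_commProd (k := k) n 0 0 a

theorem commProd_expSum_C {w : ℕ → A} (hw : EventuallyZero w) (n : ℕ) (r : k) (a : A) :
    commProd k n a (expSum (C r) w) = expSum (C r) fun m => commProd k n a (w m) :=
  expSum_map hw _ _ (commLeft k n a) fun m x => by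
    change commProd k n a _ = _ • commProd k n a x
    rw [← C_pow, ← C_mul, commProd_C_smul]

end Commutator

/-! ### The Jacobi identity in every index -/

section CommutatorAssoc

variable {k : Type*} [Field k] [CharZero k] {A : Type*} [AddCommGroup A] [Module k[X] A]
  [NProducts A] [IsAssocConformalAlgebra k A]

theorem EventuallyZero.comp {V V' : Type*} [AddCommGroup V] [AddCommGroup V'] {f : ℕ → V → V'}
    {w : ℕ → V} (hw : EventuallyZero w) (h0 : ∀ n, f n 0 = 0)
    (hf : ∀ x, EventuallyZero fun n => f n x) : EventuallyZero₂ fun n m => f n (w m) := by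
  refine EventuallyZero₂.of_right ?_ fun m => hf (w m)
  obtain ⟨M, hM⟩ := hw
  exact ⟨M, fun m hm n => by rw [hM m hm, h0]⟩

theorem expSum_expSum_commProd_commProd (r s : k) (a b c : A) :
    expSum (C r) (fun n => expSum (C s) fun m => commProd k n a (commProd k m b c)) =
      lamBracket r a (lamBracket s b c) := by
  simp only [← commProd_expSum_C (eventuallyZero_commProd k b c), expSum_commProd]

theorem eventuallyZero₂_commProd_commProd (a b c : A) :
    EventuallyZero₂ fun n m => commProd k n a (commProd k m b c) :=
  (eventuallyZero_commProd k b c).comp (f := fun n => commProd k n a) (fun n => commProd_zero n a)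
    (eventuallyZero_commProd k a)

theorem eventuallyZero₂_commProd_commProd' (a b c : A) :
    EventuallyZero₂ fun n m => commProd k m (commProd k n a b) c :=
  ((eventuallyZero_commProd k a b).comp (f := fun n x => commProd k n x c)
    (fun n => zero_commProd n c) fun x => eventuallyZero_commProd k x c).swap

/-- The Jacobi identity for commutators. -/
theorem commProd_jacobi (n m : ℕ) (a b c : A) :
    commProd k n a (commProd k m b c) - commProd k m b (commProd k n a c) =
      ∑ s ∈ Finset.range (n + 1), n.choose s • commProd k (m + s) (commProd k (n - s) a b) c := by
  have h1 := eventuallyZero₂_commProd_commProd (k := k) a b c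
  have h2 := (eventuallyZero₂_commProd_commProd (k := k) b a c).swap
  have h3 := eventuallyZero₂_commProd_commProd' (k := k) a b c
  refine eq_of_expSum_expSum_eq (k := k) (h1.sub h2) h3.sum_choose (fun r s => ?_) n m
  rw [expSum_expSum_sum_choose h3]
  rw [expSum_expSum_sub h1 h2, expSum_expSum_commProd_commProd, expSum_comm h2,
    expSum_expSum_commProd_commProd, lamBracket_lamBracket, ← C_add]
  simp only [expSum_commProd]
  rw [← expSum_lamBracket _ _ (eventuallyZero_commProd k a b), expSum_commProd]

end CommutatorAssoc

/-! ### The off-diagonal term of the twisted action -/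

section Twist

variable {k : Type*} [Field k] {A : Type*} [AddCommGroup A] [Module k[X] A] [NProducts A]

variable (k) in
/-- The shifted product `-(Da ∘ₙ b) = n (a ∘ₙ₋₁ b)`. -/
noncomputable def shiftProd (n : ℕ) (a b : A) : A := -nprod n ((X : k[X]) • a) b

variable [IsConformalAlgebra k A]

theorem shiftProd_eq (n : ℕ) (a b : A) : shiftProd k n a b = n • nprod (n - 1) a b := by
  rw [shiftProd, IsConformalAlgebra.D_nprod, neg_neg]

variable (k) in
theorem eventuallyZero_shiftProd (a b : A) : EventuallyZero fun n => shiftProd k n a b :=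
  (eventuallyZero_nprod k _ b).map (fun _ x => -x) fun _ => neg_zero

variable (k) in
theorem shiftProd_zero (n : ℕ) (a : A) : shiftProd k n a 0 = 0 := by
  rw [shiftProd, nprod_zero (k := k), neg_zero]

variable (k) in
theorem zero_shiftProd (n : ℕ) (a : A) : shiftProd k n 0 a = 0 := by
  rw [shiftProd, smul_zero, zero_nprod (k := k), neg_zero]

variable (k) in
theorem shiftProd_add (n : ℕ) (a b c : A) :
    shiftProd k n a (b + c) = shiftProd k n a b + shiftProd k n a c := by
  rw [shiftProd, IsConformalAlgebra.nprod_add k, neg_add]; rfl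

variable (k) in
theorem add_shiftProd (n : ℕ) (a b c : A) :
    shiftProd k n (a + b) c = shiftProd k n a c + shiftProd k n b c := by
  rw [shiftProd, smul_add, IsConformalAlgebra.add_nprod k, neg_add]; rfl

theorem shiftProd_C_smul (n : ℕ) (r : k) (a b : A) :
    shiftProd k n a ((C r : k[X]) • b) = (C r : k[X]) • shiftProd k n a b := by
  rw [shiftProd, IsConformalAlgebra.nprod_smul, ← smul_neg]; rfl

theorem C_smul_shiftProd (n : ℕ) (r : k) (a b : A) :
    shiftProd k n ((C r : k[X]) • a) b = (C r : k[X]) • shiftProd k n a b := by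
  rw [shiftProd, smul_comm, IsConformalAlgebra.smul_nprod, ← smul_neg]; rfl

theorem shiftProd_X_smul (n : ℕ) (a b : A) :
    shiftProd k n a ((X : k[X]) • b) =
      (X : k[X]) • shiftProd k n a b + n • shiftProd k (n - 1) a b := by
  simp only [shiftProd, IsConformalAlgebra.nprod_D, neg_add, smul_neg]

theorem X_smul_shiftProd (n : ℕ) (a b : A) :
    shiftProd k n ((X : k[X]) • a) b = -(n • shiftProd k (n - 1) a b) := by
  simp only [shiftProd, smul_neg]
  rw [IsConformalAlgebra.D_nprod]

theorem shiftProd_expSum_C {w : ℕ → A} (hw : EventuallyZero w) (n : ℕ) (r : k) (a : A) :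
    shiftProd k n a (expSum (C r) w) = expSum (C r) fun m => shiftProd k n a (w m) := by
  refine expSum_map hw _ _ (AddMonoidHom.mk' (shiftProd k n a) (shiftProd_add k n a)) fun m x => ?_
  change shiftProd k n a _ = _ • shiftProd k n a x
  rw [← C_pow, ← C_mul, shiftProd_C_smul]

theorem lamBracket_smul_C (r s : k) (a b : A) :
    lamBracket r a ((C s : k[X]) • b) = (C s : k[X]) • lamBracket r a b := by
  simp only [lamBracket, C_smul_lamProd, lamProd_C_smul, smul_sub]

variable [CharZero k]

theorem expSum_shiftProd (p : k[X]) (a b : A) :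
    expSum p (fun n => shiftProd k n a b) = p • lamProd p a b := by
  simp only [shiftProd_eq]
  exact expSum_nsmul_pred (eventuallyZero_nprod k a b) p

end Twist

/-! ### The cocycle identity in every index -/

section TwistAssoc

variable {k : Type*} [Field k] [CharZero k] {A : Type*} [AddCommGroup A] [Module k[X] A]
  [NProducts A] [IsAssocConformalAlgebra k A]

/-- The shifted left multiplication is a cocycle with respect to commutators. -/
theorem commProd_shiftProd_cocycle (n m : ℕ) (a b c : A) :
    (commProd k n a (shiftProd k m b c) + shiftProd k n a (commProd k m b c)) -
      (commProd k m b (shiftProd k n a c) + shiftProd k m b (commProd k n a c)) =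
      ∑ s ∈ Finset.range (n + 1), n.choose s • shiftProd k (m + s) (commProd k (n - s) a b) c := by
  have hcs : ∀ a b c : A, EventuallyZero₂ fun n m => commProd k n a (shiftProd k m b c) :=
    fun a b c => (eventuallyZero_shiftProd k b c).comp (f := fun n => commProd k n a)
      (fun n => commProd_zero n a) (eventuallyZero_commProd k a)
  have hsc : ∀ a b c : A, EventuallyZero₂ fun n m => shiftProd k n a (commProd k m b c) :=
    fun a b c => (eventuallyZero_commProd k b c).comp (f := fun n => shiftProd k n a)
      (fun n => shiftProd_zero k n a) (eventuallyZero_shiftProd k a)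
  have h3 : EventuallyZero₂ fun n m => shiftProd k m (commProd k n a b) c :=
    ((eventuallyZero_commProd k a b).comp (f := fun n x => shiftProd k n x c)
      (fun n => zero_shiftProd k n c) fun x => eventuallyZero_shiftProd k x c).swap
  have ecs : ∀ (r s : k) (a b c : A),
      expSum (C r) (fun n => expSum (C s) fun m => commProd k n a (shiftProd k m b c)) =
        (C s : k[X]) • lamBracket r a (lamProd (C s) b c) := by
    intro r s a b c
    simp only [← commProd_expSum_C (eventuallyZero_shiftProd k b c), expSum_commProd,
      expSum_shiftProd, lamBracket_smul_C]
  have esc : ∀ (r s : k) (a b c : A),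
      expSum (C r) (fun n => expSum (C s) fun m => shiftProd k n a (commProd k m b c)) =
        (C r : k[X]) • lamProd (C r) a (lamBracket s b c) := by
    intro r s a b c
    simp only [← shiftProd_expSum_C (eventuallyZero_commProd k b c), expSum_commProd,
      expSum_shiftProd]
  have e3 : ∀ r s : k, expSum (C r) (fun n => expSum (C s) fun m =>
      shiftProd k m (commProd k n a b) c) =
      (C s : k[X]) • lamProd (C s) (lamBracket r a b) c := by
    intro r s
    have h := eventuallyZero_commProd k a b
    simp only [expSum_shiftProd]
    rw [expSum_smul (h.map (fun _ x => lamProd (C s) x c) fun _ => (lamRight (C s) c).map_zero),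
      ← expSum_commProd, expSum_lamProd h, C_comp]
  have h1 := (hcs a b c).add (hsc a b c)
  have h2 := ((hcs b a c).add (hsc b a c)).swap
  refine eq_of_expSum_expSum_eq (k := k) (h1.sub h2) h3.sum_choose (fun r s => ?_) n m
  rw [expSum_expSum_sum_choose h3, ← C_add, e3, ← smul_lamBracket_lamProd_add]
  rw [expSum_expSum_sub h1 h2, expSum_expSum_add (hcs a b c) (hsc a b c), expSum_comm h2,
    expSum_expSum_add (hcs b a c) (hsc b a c)]
  simp only [ecs, esc]

end TwistAssoc

/-! ## Constructions of representations -/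

section Representation

variable {k : Type*} [Field k] {L : Type*} [AddCommGroup L] [Module k[X] L] [NProducts L]

/-- If `ι` is a homomorphism from the Lie conformal algebra `L` to an associative conformal algebra
`A`, then `L` acts on `A × A` by commutators, twisted by the shifted left multiplication. -/
noncomputable def twistedAdjoint [CharZero k] {A : Type*} [AddCommGroup A] [Module k[X] A]
    [NProducts A] [IsAssocConformalAlgebra k A] (ι : L →ₗ[k[X]] A)
    (hι : ∀ (n : ℕ) (a b : L), ι (nprod n a b) = commProd k n (ι a) (ι b)) :
    Representation k L (A × A) where
  act n a v := (commProd k n (ι a) v.1, commProd k n (ι a) v.2 + shiftProd k n (ι a) v.1)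
  act_add n a v w := by
    ext
    · exact commProd_add n _ _ _
    · simp only [Prod.fst_add, Prod.snd_add, commProd_add, shiftProd_add k]
      abel
  act_smul n r a v := by
    ext
    · exact commProd_C_smul n r _ _
    · simp only [Prod.smul_fst, Prod.smul_snd, commProd_C_smul, shiftProd_C_smul, smul_add]
  locality a v := by
    obtain ⟨N₁, h₁⟩ := eventuallyZero_commProd k (ι a) v.1
    obtain ⟨N₂, h₂⟩ := (eventuallyZero_commProd k (ι a) v.2).add
      (eventuallyZero_shiftProd k (ι a) v.1)
    exact ⟨N₁ + N₂, fun n hn => Prod.ext (h₁ n (by omega)) (h₂ n (by omega))⟩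
  act_D n a v := by
    ext
    · exact commProd_X_smul n _ _
    · simp only [Prod.smul_fst, Prod.smul_snd, Prod.snd_add, commProd_X_smul, shiftProd_X_smul,
        smul_add]
      abel
  add_act n a b v := by
    ext
    · simp only [map_add, Prod.fst_add, add_commProd]
    · simp only [map_add, Prod.snd_add, add_commProd, add_shiftProd k]
      abel
  smul_act n r a v := by
    ext
    · simp only [map_smul, Prod.smul_fst, C_smul_commProd]
    · simp only [map_smul, Prod.smul_snd, C_smul_commProd, C_smul_shiftProd, smul_add]
  D_act n a v := by
    ext
    · simp only [map_smul, Prod.fst_neg, Prod.smul_fst, X_smul_commProd]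
    · simp only [map_smul, Prod.snd_neg, Prod.smul_snd, X_smul_commProd, X_smul_shiftProd,
        smul_add, neg_add]
  jacobi n m a b v := by
    ext
    · simp only [Prod.fst_sub, Prod.fst_sum, Prod.smul_fst, hι]
      exact commProd_jacobi n m _ _ _
    · simp only [Prod.snd_sub, Prod.snd_sum, Prod.smul_snd, hι, smul_add, Finset.sum_add_distrib]
      -- The action is block triangular: the diagonal entries require the Jacobi identity, and the
      -- off-diagonal entry requires exactly the cocycle identity.
      rw [← commProd_jacobi n m, ← commProd_shiftProd_cocycle n m]
      simp only [commProd_add]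
      abel

namespace Representation

variable {M : Type*} [AddCommGroup M] [Module k[X] M] (ρ : Representation k L M)

/-- The restriction of a representation to an invariant submodule. -/
noncomputable def restrict (S : Submodule k[X] M) (hS : ∀ n a, ∀ v ∈ S, ρ.act n a v ∈ S) :
    Representation k L S where
  act n a v := ⟨ρ.act n a v, hS n a v v.2⟩
  act_add n a v w := Subtype.ext (ρ.act_add n a v w)
  act_smul n r a v := Subtype.ext (ρ.act_smul n r a v)
  locality a v := (ρ.locality a v).imp fun _ hN n hn => Subtype.ext (hN n hn)
  act_D n a v := Subtype.ext (ρ.act_D n a v)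
  add_act n a b v := Subtype.ext (ρ.add_act n a b v)
  smul_act n r a v := Subtype.ext (ρ.smul_act n r a v)
  D_act n a v := Subtype.ext (ρ.D_act n a v)
  jacobi n m a b v := Subtype.ext (by
    simpa using ρ.jacobi n m a b v)

/-- The action as an additive map. -/
def actHom (n : ℕ) (a : L) : M →+ M := AddMonoidHom.mk' (ρ.act n a) (ρ.act_add n a)

/-- The representation on the quotient by an invariant submodule. -/
noncomputable def quotient (S : Submodule k[X] M) (hS : ∀ n a, ∀ v ∈ S, ρ.act n a v ∈ S) :
    Representation k L (M ⧸ S) where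
  act n a := Quotient.map (ρ.act n a) (by
    intro v w h
    have h' : v - w ∈ S := (Submodule.quotientRel_def _).1 h
    refine (Submodule.quotientRel_def _).2 ?_
    rw [show ρ.act n a v - ρ.act n a w = ρ.act n a (v - w) from
      ((ρ.actHom n a).map_sub v w).symm]
    exact hS n a _ h')
  act_add n a v w := by
    induction v using Submodule.Quotient.induction_on with | _ v
    induction w using Submodule.Quotient.induction_on with | _ w
    exact congrArg Submodule.Quotient.mk (ρ.act_add n a v w)
  act_smul n r a v := by
    induction v using Submodule.Quotient.induction_on with | _ v
    exact congrArg Submodule.Quotient.mk (ρ.act_smul n r a v)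
  locality a v := by
    induction v using Submodule.Quotient.induction_on with | _ v
    exact (ρ.locality a v).imp fun _ hN n hn => congrArg Submodule.Quotient.mk (hN n hn)
  act_D n a v := by
    induction v using Submodule.Quotient.induction_on with | _ v
    exact congrArg Submodule.Quotient.mk (ρ.act_D n a v)
  add_act n a b v := by
    induction v using Submodule.Quotient.induction_on with | _ v
    exact congrArg Submodule.Quotient.mk (ρ.add_act n a b v)
  smul_act n r a v := by
    induction v using Submodule.Quotient.induction_on with | _ v
    exact congrArg Submodule.Quotient.mk (ρ.smul_act n r a v)
  D_act n a v := by
    induction v using Submodule.Quotient.induction_on with | _ v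
    exact congrArg Submodule.Quotient.mk (ρ.D_act n a v)
  jacobi n m a b v := by
    induction v using Submodule.Quotient.induction_on with | _ v
    refine (congrArg Submodule.Quotient.mk (ρ.jacobi n m a b v)).trans ?_
    rw [← Submodule.mkQ_apply, map_sum]
    exact Finset.sum_congr rfl fun s _ => map_nsmul _ _ _

/-- The transport of a representation along an isomorphism of modules. -/
noncomputable def congr {M' : Type*} [AddCommGroup M'] [Module k[X] M'] (e : M ≃ₗ[k[X]] M') :
    Representation k L M' where
  act n a v := e (ρ.act n a (e.symm v))
  act_add n a v w := by simp only [map_add, ρ.act_add]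
  act_smul n r a v := by simp only [map_smul, ρ.act_smul]
  locality a v := (ρ.locality a (e.symm v)).imp fun _ hN n hn => by rw [hN n hn, map_zero]
  act_D n a v := by simp only [map_smul, ρ.act_D, map_add, map_nsmul]
  add_act n a b v := by simp only [map_add, ρ.add_act]
  smul_act n r a v := by simp only [map_smul, ρ.smul_act]
  D_act n a v := by simp only [ρ.D_act, map_neg, map_nsmul]
  jacobi n m a b v := by
    simp only [LinearEquiv.symm_apply_apply, ← map_sub, ρ.jacobi, map_sum, map_nsmul]

theorem expSum_act_X_smul [CharZero k] (r : k) (a : L) (v : M) :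
    expSum (C r) (fun n => ρ.act n a ((X : k[X]) • v)) =
      (X + C r) • expSum (C r) fun n => ρ.act n a v := by
  have h : EventuallyZero fun n => ρ.act n a v := ρ.locality a v
  simp only [ρ.act_D]
  rw [expSum_add (h.map (fun _ x => (X : k[X]) • x) fun _ => smul_zero _) h.nsmul_pred,
    expSum_nsmul_pred h, expSum_smul h, add_smul]

theorem expSum_act_smul [CharZero k] (r : k) (a : L) (f : k[X]) (v : M) :
    expSum (C r) (fun n => ρ.act n a (f • v)) =
      f.comp (X + C r) • expSum (C r) fun n => ρ.act n a v := by
  induction f using Polynomial.induction_on generalizing v with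
  | C t =>
    simp only [ρ.act_smul, C_comp]
    exact expSum_smul (ρ.locality a v) _ _
  | add f g hf hg =>
    simp only [add_smul, ρ.act_add, add_comp]
    rw [expSum_add (ρ.locality a _) (ρ.locality a _), hf, hg]
  | monomial i t ih =>
    rw [pow_succ, ← mul_assoc, mul_smul, ih, expSum_act_X_smul, smul_smul,
      mul_comp (C t * X ^ i) X, X_comp]

/-- If `f v = 0` then `f(D + r)` kills `a_r v`, and a translate of a nonzero polynomial is nonzero.
The coefficients of `a_λ v` are then torsion by interpolation. -/
theorem act_mem_torsion [CharZero k] (n : ℕ) (a : L) {v : M}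
    (hv : v ∈ Submodule.torsion k[X] M) : ρ.act n a v ∈ Submodule.torsion k[X] M := by
  refine mem_of_expSum_mem (k := k) (Submodule.torsion k[X] M) (ρ.locality a v) (fun r => ?_) n
  obtain ⟨⟨f, hf⟩, hfv⟩ := (Submodule.mem_torsion_iff v).1 hv
  refine (Submodule.mem_torsion_iff _).2 ⟨⟨f.comp (X + C r), ?_⟩, ?_⟩
  · rw [mem_nonZeroDivisors_iff_ne_zero] at hf ⊢
    rwa [Ne, comp_X_add_C_eq_zero_iff]
  · change f • v = 0 at hfv
    change f.comp (X + C r) • (expSum (C r) fun n => ρ.act n a v) = 0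
    rw [← expSum_act_smul, hfv]
    simp only [show ∀ n, ρ.act n a 0 = 0 from fun n => (ρ.actHom n a).map_zero, expSum_zero]

/-- A representation on a finitely generated module, such that nonzero elements act nontrivially
modulo torsion, gives a faithful representation on a free module of finite rank. -/
theorem exists_faithful_free {k : Type u} [Field k] [CharZero k] {L : Type*} [AddCommGroup L]
    [Module k[X] L] [NProducts L] {M : Type*} [AddCommGroup M] [Module k[X] M]
    [Module.Finite k[X] M] (ρ : Representation k L M)
    (h : ∀ a : L, (∀ n v, ρ.act n a v ∈ Submodule.torsion k[X] M) → a = 0) :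
    ∃ (M' : Type u) (_ : AddCommGroup M') (_ : Module k[X] M'),
      Module.Finite k[X] M' ∧ Module.Free k[X] M' ∧
        ∃ ρ' : Representation k L M', ρ'.IsFaithful := by
  let T := Submodule.torsion k[X] M
  let ρ₁ := ρ.quotient T fun n a v hv => ρ.act_mem_torsion n a hv
  have : Module.Free k[X] (M ⧸ T) := Module.free_of_finite_type_torsion_free'
  -- Passing to coordinates places the module in the universe of `k`.
  let e := (Module.finBasis k[X] (M ⧸ T)).equivFun
  refine ⟨_, _, _, inferInstance, inferInstance, ρ₁.congr e, fun a b hab => ?_⟩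
  refine sub_eq_zero.1 (h _ fun n v => ?_)
  have h1 := congrFun (congrFun hab n) (e (Submodule.Quotient.mk v))
  have h2 : ρ₁.act n a (Submodule.Quotient.mk v) = ρ₁.act n b (Submodule.Quotient.mk v) := by
    simpa [Representation.congr] using h1
  have h3 : ρ.act n (a - b) v = ρ.act n a v - ρ.act n b v := by
    rw [eq_sub_iff_add_eq, ← ρ.add_act, sub_add_cancel]
  rw [h3]
  exact (Submodule.Quotient.eq T).1 h2

end Representation

end Representation

/-! ## A finite invariant submodule of the twisted adjoint representation -/

section ProductSpan

variable {k : Type*} [Field k] {L : Type*} [AddCommGroup L] [Module k[X] L]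
  {A : Type*} [AddCommGroup A] [Module k[X] A] [NProducts A]

/-- The `H`-span of all products of two elements of the image of `ι`. -/
noncomputable def productSpan (ι : L →ₗ[k[X]] A) : Submodule k[X] A :=
  Submodule.span k[X] {x | ∃ (n : ℕ) (a b : L), x = nprod n (ι a) (ι b)}

theorem nprod_mem_productSpan (ι : L →ₗ[k[X]] A) (n : ℕ) (a b : L) :
    nprod n (ι a) (ι b) ∈ productSpan ι := Submodule.subset_span ⟨n, a, b, rfl⟩

/-- Two generators of `L` have finitely many nonzero products by locality, and sesquilinearity
expresses the products of all other pairs as `H`-combinations of these. -/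
theorem productSpan_fg [IsConformalAlgebra k A] [Module.Finite k[X] L] (ι : L →ₗ[k[X]] A) :
    (productSpan ι).FG := by
  obtain ⟨G, hG⟩ := Module.Finite.fg_top (R := k[X]) (M := L)
  choose N hN using fun a b : L => IsConformalAlgebra.locality k (ι a) (ι b)
  let F : Set A := ⋃ a ∈ G, ⋃ b ∈ G, (fun n => nprod n (ι a) (ι b)) '' Set.Iio (N a b)
  have hF : F.Finite := Set.Finite.biUnion G.finite_toSet fun a _ =>
    Set.Finite.biUnion G.finite_toSet fun b _ => (Set.finite_Iio _).image _
  have hgen : ∀ a ∈ G, ∀ b ∈ G, ∀ n, nprod n (ι a) (ι b) ∈ Submodule.span k[X] F := by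
    intro a ha b hb n
    rcases lt_or_ge n (N a b) with hn | hn
    · exact Submodule.subset_span (Set.mem_biUnion ha (Set.mem_biUnion hb ⟨n, hn, rfl⟩))
    · rw [hN a b n hn]; exact zero_mem _
  have hall : ∀ a b : L, ∀ n, nprod n (ι a) (ι b) ∈ Submodule.span k[X] F := by
    intro a b
    have ha : a ∈ Submodule.span k[X] (G : Set L) := hG ▸ Submodule.mem_top
    have hb : b ∈ Submodule.span k[X] (G : Set L) := hG ▸ Submodule.mem_top
    induction ha using Submodule.span_induction with
    | mem a ha =>
      induction hb using Submodule.span_induction with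
      | mem b hb => exact hgen a ha b hb
      | zero => intro n; rw [map_zero, nprod_zero (k := k)]; exact zero_mem _
      | add b b' _ _ h h' =>
        intro n; rw [map_add, IsConformalAlgebra.nprod_add k]; exact add_mem (h n) (h' n)
      | smul f b _ h => intro n; rw [map_smul]; exact nprod_smul_mem _ _ _ h f n
    | zero => intro n; rw [map_zero, zero_nprod (k := k)]; exact zero_mem _
    | add a a' _ _ h h' =>
      intro n; rw [map_add, IsConformalAlgebra.add_nprod k]; exact add_mem (h n) (h' n)
    | smul f a _ h => intro n; rw [map_smul]; exact smul_nprod_mem _ _ _ h f n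
  rw [show productSpan ι = Submodule.span k[X] F from le_antisymm
    (Submodule.span_le.2 fun x ⟨n, a, b, hx⟩ => hx ▸ hall a b n)
    (Submodule.span_mono fun x hx => by
      simp only [F, Set.mem_iUnion] at hx
      obtain ⟨a, _, b, _, n, _, rfl⟩ := hx
      exact ⟨n, a, b, rfl⟩)]
  exact Submodule.fg_span hF

theorem commProd_smul_mem [CharZero k] [IsConformalAlgebra k A] (I : Submodule k[X] A) (a b : A)
    (h : ∀ n, commProd k n a b ∈ I) (f : k[X]) (n : ℕ) : commProd k n a (f • b) ∈ I := by
  induction f using Polynomial.induction_on generalizing b n with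
  | C r => rw [commProd_C_smul]; exact I.smul_mem _ (h n)
  | add f g hf hg => rw [add_smul, commProd_add]; exact I.add_mem (hf b h n) (hg b h n)
  | monomial i r ih =>
    rw [pow_succ, ← mul_assoc, mul_smul]
    refine ih _ (fun m => ?_) n
    rw [commProd_X_smul]
    exact I.add_mem (I.smul_mem _ (h _)) (I.smul_of_tower_mem m (h _))

variable [NProducts L] [CharZero k] [IsAssocConformalAlgebra k A] (ι : L →ₗ[k[X]] A)
  (hι : ∀ (n : ℕ) (a b : L), ι (nprod n a b) = commProd k n (ι a) (ι b))

include hι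

/-- By the Leibniz rule the commutator falls on one of the two factors, and a commutator of elements
of `ι(L)` lies in `ι(L)` again. Thus products of length two are preserved. -/
theorem commProd_nprod_mem_productSpan (n m : ℕ) (a b c : L) :
    commProd k n (ι a) (nprod m (ι b) (ι c)) ∈ productSpan ι := by
  have h := eventuallyZero_nprod k (ι b) (ι c)
  refine mem_of_expSum_expSum_mem (k := k) (productSpan ι)
    (h.comp (f := fun n => commProd k n (ι a)) (fun n => commProd_zero n _)
      (eventuallyZero_commProd k (ι a))) (fun r s => ?_) n m
  have hlam : ∀ (p : k[X]) (a b : L), lamProd p (ι a) (ι b) ∈ productSpan ι := fun p a b =>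
    expSum_mem (eventuallyZero_nprod k _ _) (fun n => nprod_mem_productSpan ι n a b) p
  simp only [← commProd_expSum_C h, expSum_commProd]
  rw [← lamProd.eq_1, lamBracket_lamProd, ← expSum_commProd, ← expSum_commProd]
  simp only [← hι]
  have h1 : ∀ a b, EventuallyZero fun n => ι (nprod n a b) := fun a b => by
    simpa only [hι] using eventuallyZero_commProd k (ι a) (ι b)
  refine add_mem ?_ ?_
  · rw [expSum_lamProd (h1 a b)]
    exact expSum_mem ((h1 a b).map (fun _ x => lamProd (C (r + s)) x (ι c))
      fun _ => (lamRight (C (r + s)) (ι c)).map_zero) (fun n => hlam _ _ _) _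
  · rw [lamProd_expSum (h1 a c)]
    exact expSum_mem ((h1 a c).map (fun _ x => lamProd (C s) (ι b) x)
      fun _ => (lamLeft (C s) (ι b)).map_zero) (fun n => hlam _ _ _) _

theorem commProd_mem_productSpan (n : ℕ) (a : L) {x : A} (hx : x ∈ productSpan ι) :
    commProd k n (ι a) x ∈ productSpan ι := by
  induction hx using Submodule.span_induction generalizing n with
  | mem x hx =>
    obtain ⟨m, b, c, rfl⟩ := hx
    exact commProd_nprod_mem_productSpan ι hι n m a b c
  | zero => rw [commProd_zero]; exact zero_mem _
  | add x y _ _ h h' => rw [commProd_add]; exact add_mem (h n) (h' n)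
  | smul f x _ h => exact commProd_smul_mem _ _ _ h f n

theorem twistedAdjoint_mem (n : ℕ) (a : L) (v : A × A)
    (hv : v ∈ (LinearMap.range ι).prod (productSpan ι)) :
    (twistedAdjoint ι hι).act n a v ∈ (LinearMap.range ι).prod (productSpan ι) := by
  obtain ⟨⟨c, hc⟩, h2⟩ := hv
  refine ⟨⟨nprod n a c, ?_⟩, add_mem (commProd_mem_productSpan ι hι n a h2) ?_⟩
  · rw [hι, hc]; rfl
  · rw [← hc, shiftProd_eq]
    exact (productSpan ι).smul_of_tower_mem n (nprod_mem_productSpan ι _ _ _)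

omit hι in
/-- A Lie conformal algebra that maps to an associative one in such a way that the squares of the
images of nonzero elements are not torsion has a finite faithful representation on a free module. -/
theorem exists_faithful_free_of_nprod_notMem_torsion {k : Type u} [Field k] [CharZero k]
    {L : Type*} [AddCommGroup L] [Module k[X] L] [NProducts L] [Module.Finite k[X] L]
    {A : Type*} [AddCommGroup A] [Module k[X] A] [NProducts A] [IsAssocConformalAlgebra k A]
    (ι : L →ₗ[k[X]] A)
    (hι : ∀ (n : ℕ) (a b : L), ι (nprod n a b) = commProd k n (ι a) (ι b))
    (h : ∀ a : L, (∀ n, nprod n (ι a) (ι a) ∈ Submodule.torsion k[X] A) → a = 0) :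
    ∃ (M : Type u) (_ : AddCommGroup M) (_ : Module k[X] M),
      Module.Finite k[X] M ∧ Module.Free k[X] M ∧
        ∃ ρ : Representation k L M, ρ.IsFaithful := by
  have hfg : ((LinearMap.range ι).prod (productSpan ι)).FG :=
    Submodule.FG.prod (Module.Finite.iff_fg.1 inferInstance) (productSpan_fg ι)
  have := Module.Finite.of_fg hfg
  refine Representation.exists_faithful_free
    ((twistedAdjoint ι hι).restrict _ (twistedAdjoint_mem ι hι)) fun a ha => h a fun n => ?_
  obtain ⟨⟨f, hf⟩, hfa⟩ := (Submodule.mem_torsion_iff _).1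
    -- On this vector the second entry has no commutator part, and the shift in index turns `n + 1`
    -- into `(n + 1) (ι a ∘ₙ ι a)`. The factor `n + 1` is absorbed in the annihilator, which stays
    -- nonzero in characteristic zero.
    (ha (n + 1) ⟨(ι a, 0), ⟨a, rfl⟩, zero_mem _⟩)
  have h1 : f • (commProd k (n + 1) (ι a) 0 + shiftProd k (n + 1) (ι a) (ι a)) = 0 :=
    congrArg (fun v => v.1.2) hfa
  rw [commProd_zero, zero_add, shiftProd_eq, Nat.add_sub_cancel, ← Nat.cast_smul_eq_nsmul k[X],
    smul_smul] at h1
  refine (Submodule.mem_torsion_iff _).2 ⟨⟨f * ((n + 1 : ℕ) : k[X]), ?_⟩, h1⟩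
  exact mul_mem hf (mem_nonZeroDivisors_of_ne_zero (Nat.cast_ne_zero.2 n.succ_ne_zero))

end ProductSpan

/-! ### The canonical map to the envelope turns brackets into commutators -/

theorem map_braceProd {k : Type*} [Field k] {A A' : Type*} [AddCommGroup A] [Module k[X] A]
    [NProducts A] [IsConformalAlgebra k A] [AddCommGroup A'] [Module k[X] A'] [NProducts A']
    (φ : A →ₗ[k[X]] A') (hφ : ∀ (n : ℕ) (a b : A), φ (nprod n a b) = nprod n (φ a) (φ b))
    (n : ℕ) (a b : A) : φ (braceProd k n a b) = braceProd k n (φ a) (φ b) := by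
  obtain ⟨N, hN⟩ := IsConformalAlgebra.locality k a b
  rw [braceProd_eq hN, braceProd_eq (N := N) fun n hn => by rw [← hφ, hN n hn, map_zero], map_sum]
  simp only [map_smul, hφ]

theorem Envelope.ι_nprod {k : Type u} [Field k] {L : Type v} [AddCommGroup L] [Module k[X] L]
    [NProducts L] {β : Type w} (B : Module.Basis β k[X] L) (N : β → β → ℕ) (n : ℕ) (a b : L) :
    Envelope.ι B N (nprod n a b) = commProd k n (Envelope.ι B N a) (Envelope.ι B N b) := by
  have h : nprod n (toFree B N a) (toFree B N b) - braceProd k n (toFree B N b) (toFree B N a) -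
      toFree B N (nprod n a b) ∈ idealSpan k (envelopeRelations B N) := by
    simp only [idealSpan, Submodule.mem_sInf]
    exact fun I hI => hI.1 ⟨n, a, b, rfl⟩
  have h1 := (Submodule.Quotient.mk_eq_zero _).2 h
  rw [← Submodule.mkQ_apply, map_sub, map_sub, sub_eq_zero,
    map_braceProd _ fun n a b => mk_nprod _ n a b] at h1
  exact h1.symm

/-! ## The universal property of free commutative conformal algebras -/

section Lift

variable {k : Type u} [Field k] {β : Type w} {Q : Type*} [AddCommGroup Q] [Module k[X] Q]
  [NProducts Q]

/-- The value of a formal expression. -/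
noncomputable def Expr.eval (γ : β → Q) : Expr k β → Q
  | .gen x => γ x
  | .zero => 0
  | .add a b => a.eval γ + b.eval γ
  | .smul f a => f • a.eval γ
  | .prod n a b => nprod n (a.eval γ) (b.eval γ)

theorem Expr.eval_sum (γ : β → Q) (f : ℕ → Expr k β) (n : ℕ) :
    (Expr.sum f n).eval γ = ∑ s ∈ Finset.range n, (f s).eval γ := by
  induction n with
  | zero => rfl
  | succ n ih => rw [Finset.sum_range_succ, ← ih]; rfl

variable [IsAssocConformalAlgebra k Q] {N : β → β → ℕ} (γ : β → Q)
  (hγ : ∀ (n : ℕ) (x y : β), N x y ≤ n → nprod n (γ x) (γ y) = 0)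

include hγ in
theorem FreeRel.eval_eq {a b : Expr k β} (h : FreeRel k N a b) : a.eval γ = b.eval γ := by
  induction h with
  | refl => rfl
  | symm _ h => exact h.symm
  | trans _ _ h h' => exact h.trans h'
  | add_congr _ _ h h' => simp only [Expr.eval, h, h']
  | smul_congr f _ h => simp only [Expr.eval, h]
  | prod_congr n _ _ h h' => simp only [Expr.eval, h, h']
  | add_assoc => exact _root_.add_assoc _ _ _
  | add_comm => exact _root_.add_comm _ _
  | zero_add => exact _root_.zero_add _
  | smul_add => exact _root_.smul_add _ _ _
  | add_smul => exact _root_.add_smul _ _ _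
  | mul_smul => exact SemigroupAction.mul_smul _ _ _
  | one_smul => exact _root_.one_smul _ _
  | zero_smul => exact _root_.zero_smul _ _
  | add_prod => exact IsConformalAlgebra.add_nprod k _ _ _ _
  | prod_add => exact IsConformalAlgebra.nprod_add k _ _ _ _
  | smul_prod => exact IsConformalAlgebra.smul_nprod _ _ _ _
  | prod_smul => exact IsConformalAlgebra.nprod_smul _ _ _ _
  | D_prod n a b =>
    simp only [Expr.eval, neg_smul, Nat.cast_smul_eq_nsmul]
    exact IsConformalAlgebra.D_nprod _ _ _
  | prod_D n a b =>
    simp only [Expr.eval, Nat.cast_smul_eq_nsmul]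
    exact IsConformalAlgebra.nprod_D _ _ _
  | assoc n m a b c =>
    rw [Expr.eval_sum]
    simp only [Expr.eval, Nat.cast_smul_eq_nsmul]
    exact IsAssocConformalAlgebra.assoc k n m _ _ _
  | locality n x y h => exact hγ n x y h

/-- The homomorphism from a free associative conformal algebra with given values on generators. -/
noncomputable def FreeAssoc.lift : FreeAssoc k N →ₗ[k[X]] Q where
  toFun := Quotient.lift (s := freeSetoid k N) (Expr.eval γ) fun _ _ h => h.eval_eq γ hγ
  map_add' := FreeAssoc.ind fun _ => FreeAssoc.ind fun _ => rfl
  map_smul' _ := FreeAssoc.ind fun _ => rfl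

theorem FreeAssoc.lift_nprod (n : ℕ) (a b : FreeAssoc k N) :
    FreeAssoc.lift γ hγ (nprod n a b) =
      nprod n (FreeAssoc.lift γ hγ a) (FreeAssoc.lift γ hγ b) := by
  induction a using FreeAssoc.ind with | _ a
  induction b using FreeAssoc.ind with | _ b
  rfl

variable (hQ : ∀ (n : ℕ) (a b : Q), nprod n a b = braceProd k n b a)

/-- The homomorphism from a free commutative conformal algebra with given values on generators. -/
noncomputable def FreeComm.lift : FreeComm k N →ₗ[k[X]] Q :=
  (idealSpan k (commRelations k (FreeAssoc k N))).liftQ (FreeAssoc.lift γ hγ) <|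
    sInf_le ⟨by
      rintro x ⟨n, a, b, rfl⟩
      rw [SetLike.mem_coe, LinearMap.mem_ker, map_sub, map_braceProd _ (FreeAssoc.lift_nprod γ hγ),
        FreeAssoc.lift_nprod, hQ, sub_self], by
      intro n a b ha
      rw [LinearMap.mem_ker] at ha
      rw [LinearMap.mem_ker, LinearMap.mem_ker, FreeAssoc.lift_nprod, FreeAssoc.lift_nprod, ha,
        zero_nprod (k := k), nprod_zero (k := k)]
      exact ⟨rfl, rfl⟩⟩

theorem FreeComm.lift_nprod (n : ℕ) (a b : FreeComm k N) :
    FreeComm.lift γ hγ hQ (nprod n a b) =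
      nprod n (FreeComm.lift γ hγ hQ a) (FreeComm.lift γ hγ hQ b) := by
  induction a using Submodule.Quotient.induction_on with | _ a
  induction b using Submodule.Quotient.induction_on with | _ b
  exact FreeAssoc.lift_nprod γ hγ n a b

end Lift

/-! ## A nilpotent quotient of the current algebra of polynomials -/

section CurTrunc

variable {k : Type*} [Field k]

/-- The substitution `D ↦ -λ`. -/
noncomputable def evalNeg (k : Type*) [Field k] : k[X] →ₐ[k] k[X][X] := aeval (-X)

/-- The substitution `D ↦ D + λ`. -/
noncomputable def evalShift (k : Type*) [Field k] : k[X] →ₐ[k] k[X][X] := aeval (C X + X)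

/-- The `n`-product of the current conformal algebra of rank one: `f_λ g = f(-λ) g(D + λ)`. -/
noncomputable def curProd (n : ℕ) (f g : k[X]) : k[X] :=
  n.factorial • (evalNeg k f * evalShift k g).coeff n

theorem algHom_C (φ : k[X] →ₐ[k] k[X][X]) (r : k) : φ (C r) = C (C r) := φ.commutes r

theorem evalNeg_X : evalNeg k X = -X := aeval_X _

theorem evalShift_X : evalShift k X = C X + X := aeval_X _

/-- Substituting `-λ` for `λ` recovers `f`. -/
theorem evalNeg_injective : Function.Injective (evalNeg k) := by
  have h : ∀ f, evalNeg k f = (f.map C).comp (-X) := fun f => by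
    rw [evalNeg, aeval_def, Polynomial.comp, eval₂_map]; rfl
  intro f g hfg
  rw [h, h] at hfg
  have h1 := congrArg (fun p => p.comp (-X)) hfg
  simp only [comp_assoc, neg_comp, X_comp, neg_neg, comp_X] at h1
  exact map_injective _ C_injective h1

/-- Setting `λ = 0` recovers `f`. -/
theorem evalShift_injective : Function.Injective (evalShift k) := by
  intro f g hfg
  have h : ∀ f, (evalShift k f).eval 0 = f := fun f => by
    rw [← coe_evalRingHom]
    induction f using Polynomial.induction_on' with
    | add f g hf hg => rw [map_add, map_add, hf, hg]
    | monomial n r =>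
      rw [← C_mul_X_pow_eq_monomial, map_mul, map_pow, algHom_C, evalShift_X]
      simp
  rw [← h f, ← h g, hfg]

/-- The ring `k[D][λ]` is a domain, so `f(-λ) g(D+λ)` is nonzero, and the factorials are invertible.
-/
theorem curProd_ne_zero [CharZero k] {f g : k[X]} (hf : f ≠ 0) (hg : g ≠ 0) :
    ∃ n, curProd n f g ≠ 0 := by
  have h : evalNeg k f * evalShift k g ≠ 0 :=
    mul_ne_zero ((map_ne_zero_iff _ evalNeg_injective).2 hf)
      ((map_ne_zero_iff _ evalShift_injective).2 hg)
  by_contra! hcon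
  refine h (Polynomial.ext fun n => ?_)
  exact (smul_eq_zero.1 (hcon n)).resolve_left n.factorial_ne_zero

theorem curProd_C_C {n : ℕ} (hn : n ≠ 0) (r s : k) : curProd n (C r) (C s) = 0 := by
  rw [curProd, algHom_C, algHom_C, ← C_mul, coeff_C_of_ne_zero hn, smul_zero]

/-- The quotient of the current conformal algebra over the augmentation ideal of `k[x]` by the
elements of degree at least three in `x`. -/
def CurTrunc (k : Type*) [Field k] : Type _ := k[X] × k[X]

noncomputable instance : AddCommGroup (CurTrunc k) := inferInstanceAs (AddCommGroup (k[X] × k[X]))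

noncomputable instance : Module k[X] (CurTrunc k) := inferInstanceAs (Module k[X] (k[X] × k[X]))

noncomputable instance : NProducts (CurTrunc k) where
  nprod n a b := (0, curProd n a.1 b.1)

theorem CurTrunc.nprod_def (n : ℕ) (a b : CurTrunc k) :
    nprod n a b = ((0, curProd n a.1 b.1) : k[X] × k[X]) := rfl

theorem coeff_succ_factorial (P : k[X][X]) (n : ℕ) :
    n.factorial • (X * P).coeff n = n • ((n - 1).factorial • P.coeff (n - 1)) := by
  cases n with
  | zero => simp
  | succ n =>
    rw [coeff_X_mul, smul_smul, Nat.add_sub_cancel, Nat.factorial_succ]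

theorem curProd_zero (n : ℕ) (f : k[X]) : curProd n f 0 = 0 := by
  simp [curProd]

theorem zero_curProd (n : ℕ) (f : k[X]) : curProd n 0 f = 0 := by
  simp [curProd]

theorem add_curProd (n : ℕ) (f g h : k[X]) :
    curProd n (f + g) h = curProd n f h + curProd n g h := by
  simp only [curProd, map_add, add_mul, coeff_add, smul_add]

theorem curProd_add (n : ℕ) (f g h : k[X]) :
    curProd n f (g + h) = curProd n f g + curProd n f h := by
  simp only [curProd, map_add, mul_add, coeff_add, smul_add]

theorem C_mul_curProd (n : ℕ) (r : k) (f g : k[X]) :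
    curProd n (C r * f) g = C r * curProd n f g := by
  simp only [curProd, map_mul, algHom_C, mul_assoc, coeff_C_mul, mul_smul_comm]

theorem curProd_C_mul (n : ℕ) (r : k) (f g : k[X]) :
    curProd n f (C r * g) = C r * curProd n f g := by
  rw [curProd, map_mul, algHom_C, mul_left_comm, coeff_C_mul, ← mul_smul_comm, curProd]

theorem X_mul_curProd (n : ℕ) (f g : k[X]) :
    curProd n (X * f) g = -(n • curProd (n - 1) f g) := by
  have h : -X * evalNeg k f * evalShift k g = -(X * (evalNeg k f * evalShift k g)) := by ring
  rw [curProd, map_mul, evalNeg_X, h, coeff_neg, smul_neg, coeff_succ_factorial, curProd]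

theorem curProd_X_mul (n : ℕ) (f g : k[X]) :
    curProd n f (X * g) = X * curProd n f g + n • curProd (n - 1) f g := by
  rw [curProd, map_mul, evalShift_X, add_mul, mul_add, coeff_add, smul_add, mul_left_comm,
    coeff_C_mul, mul_left_comm _ X, coeff_succ_factorial, ← mul_smul_comm, curProd, curProd]

instance : IsAssocConformalAlgebra k (CurTrunc k) where
  add_nprod n a b c := Prod.ext (add_zero (0 : k[X])).symm (add_curProd n a.1 b.1 c.1)
  nprod_add n a b c := Prod.ext (add_zero (0 : k[X])).symm (curProd_add n a.1 b.1 c.1)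
  smul_nprod n r a b := Prod.ext (mul_zero (C r : k[X])).symm (C_mul_curProd n r a.1 b.1)
  nprod_smul n r a b := Prod.ext (mul_zero (C r : k[X])).symm (curProd_C_mul n r a.1 b.1)
  locality a b := ⟨(evalNeg k a.1 * evalShift k b.1).natDegree + 1, fun n hn => Prod.ext rfl (by
    change curProd n a.1 b.1 = 0
    rw [curProd, coeff_eq_zero_of_natDegree_lt (by omega), smul_zero])⟩
  D_nprod n a b := Prod.ext (by
    change (0 : k[X]) = -(n • 0)
    rw [smul_zero, neg_zero]) (X_mul_curProd n a.1 b.1)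
  nprod_D n a b := Prod.ext (by
    change (0 : k[X]) = X * 0 + n • 0
    rw [mul_zero, smul_zero, add_zero]) (curProd_X_mul n a.1 b.1)
  assoc n m a b c := by
    -- All triple products vanish, with either bracketing.
    rw [Finset.sum_eq_zero]
    · exact Prod.ext rfl (curProd_zero n _)
    · intro s _
      rw [show nprod (m + s) (nprod (n - s) a b) c = 0 from Prod.ext rfl (zero_curProd _ _),
        smul_zero]

/-- The generator of `CurTrunc k`. -/
noncomputable def CurTrunc.one (k : Type*) [Field k] : CurTrunc k := ((1, 0) : k[X] × k[X])

theorem CurTrunc.smul_one_fst (f : k[X]) : (f • CurTrunc.one k).1 = f := mul_one f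

theorem CurTrunc.nprod_congr (n : ℕ) {a a' b b' : CurTrunc k} (ha : a.1 = a'.1)
    (hb : b.1 = b'.1) : nprod n a b = nprod n a' b' := by
  rw [nprod_def, nprod_def, ha, hb]

theorem CurTrunc.nprod_one_one {n : ℕ} (hn : n ≠ 0) :
    nprod n (CurTrunc.one k) (CurTrunc.one k) = 0 :=
  Prod.ext rfl (curProd_C_C hn 1 1)

/-- The generator has only a `0`-product with itself, so `x_p x` does not depend on `p` and
sesquilinearity gives the rest. -/
theorem CurTrunc.lamProd_eq [CharZero k] (p : k[X]) (a b : CurTrunc k) :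
    lamProd p a b = (a.1.comp (-p) * b.1.comp (X + p)) •
      (nprod 0 (CurTrunc.one k) (CurTrunc.one k) : CurTrunc k) := by
  have h1 : lamProd p a b = lamProd p (a.1 • CurTrunc.one k) (b.1 • CurTrunc.one k) :=
    congrArg (expSum p) (funext fun n => nprod_congr n (smul_one_fst _).symm (smul_one_fst _).symm)
  rw [h1, smul_lamProd, lamProd_smul, smul_smul, lamProd,
    expSum_eq (N := 1) fun n hn => nprod_one_one (by omega)]
  simp only [Finset.range_one, Finset.sum_singleton, Nat.factorial_zero, Nat.cast_one, inv_one, C_1,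
    pow_zero, mul_one, one_smul]

/-- Replacing `λ` by `-λ - D` interchanges `-λ` and `D + λ`, hence the two factors in the formula
for the product. -/
theorem CurTrunc.nprod_comm [CharZero k] (n : ℕ) (a b : CurTrunc k) :
    nprod n a b = braceProd k n b a := by
  refine eq_of_expSum_eq (k := k) (eventuallyZero_nprod k a b) (eventuallyZero_braceProd b a)
    (fun r => ?_) n
  rw [expSum_braceProd, ← lamProd.eq_1, lamProd_eq, lamProd_eq, mul_comm]
  congr 3 <;> ring

end CurTrunc

/-! ## The associated graded algebra -/

section Gr

variable {k : Type*} [Field k] {A : Type*} [AddCommGroup A] [Module k[X] A] [NProducts A]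

variable (k) in
/-- The class of an element of the `i`-th term of the filtration. -/
noncomputable def grMk (S : Set A) (i : ℕ) : filt k S i →ₗ[k[X]] Gr k S :=
  DirectSum.lof k[X] ℕ (GrComponent k S) i ∘ₗ ((filt k S (i - 1)).submoduleOf (filt k S i)).mkQ

theorem grMk_eq_zero (S : Set A) {i : ℕ} {x : filt k S i} (hx : x.1 ∈ filt k S (i - 1)) :
    grMk k S i x = 0 := by
  rw [grMk, LinearMap.comp_apply, Submodule.mkQ_apply, (Submodule.Quotient.mk_eq_zero _).2,
    map_zero]
  exact hx

theorem mem_filt_one {S : Set A} {x : A} (hx : x ∈ S) : x ∈ filt k S 1 :=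
  Submodule.subset_span ⟨1, le_rfl, .gen hx⟩

variable [IsConformalAlgebra k A]

theorem nprod_grMk (S : Set A) (n i j : ℕ) (x : filt k S i) (y : filt k S j) :
    nprod n (grMk k S i x) (grMk k S j y) =
      grMk k S (i + j) ⟨nprod n x.1 y.1, nprod_mem_filt x.2 y.2 n⟩ := by
  change (DirectSum.toAddMonoid (fun i => AddMonoidHom.flip <| DirectSum.toAddMonoid fun j =>
    AddMonoidHom.flip <| (DirectSum.of (GrComponent k S) (i + j)).compHom.comp
      (grProdHom k S n i j)) (DirectSum.of (GrComponent k S) i (Submodule.Quotient.mk x)) :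
        Gr k S →+ Gr k S) (DirectSum.of (GrComponent k S) j (Submodule.Quotient.mk y)) = _
  rw [DirectSum.toAddMonoid_of, AddMonoidHom.flip_apply, DirectSum.toAddMonoid_of]
  rfl

/-- A linear map that vanishes on all products is determined by the component of degree one. -/
theorem range_le_of_nprod (S : Set A) {V : Type*} [AddCommGroup V] [Module k[X] V]
    (Γ : Gr k S →ₗ[k[X]] V) (R : Submodule k[X] V) (hΓ : ∀ n x y, Γ (nprod n x y) = 0)
    (hR : ∀ x (hx : x ∈ S), Γ (grMk k S 1 ⟨x, mem_filt_one hx⟩) ∈ R) :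
    LinearMap.range Γ ≤ R := by
  have key : ∀ (i : ℕ) (y : A) (hy : y ∈ filt k S i), Γ (grMk k S i ⟨y, hy⟩) ∈ R := by
    intro i y hy
    induction hy using Submodule.span_induction with
    | mem y hy =>
      obtain ⟨l, hl, hw⟩ := hy
      -- A word shorter than `i` has class zero in degree `i`. One of length exactly `i` is either a
      -- generator or a product of two classes, which `Γ` kills.
      rcases hl.lt_or_eq with hl | rfl
      · rw [grMk_eq_zero S (Submodule.subset_span ⟨l, by omega, hw⟩), map_zero]
        exact zero_mem _
      · cases hw with
        | gen h => exact hR y h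
        | @prod i j a b n ha hb =>
          have ha' : a ∈ filt k S i := Submodule.subset_span ⟨i, le_rfl, ha⟩
          have hb' : b ∈ filt k S j := Submodule.subset_span ⟨j, le_rfl, hb⟩
          rw [← nprod_grMk S n i j ⟨a, ha'⟩ ⟨b, hb'⟩, hΓ]
          exact zero_mem _
    | zero => exact (Γ ∘ₗ grMk k S i).map_zero ▸ zero_mem _
    | add x y hx hy h h' =>
      have := (Γ ∘ₗ grMk k S i).map_add ⟨x, hx⟩ ⟨y, hy⟩
      exact this ▸ add_mem h h'
    | smul f x hx h =>
      have := (Γ ∘ₗ grMk k S i).map_smul f ⟨x, hx⟩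
      exact this ▸ R.smul_mem f h
  rintro _ ⟨x, rfl⟩
  induction x using DirectSum.induction_on with
  | zero => rw [map_zero]; exact zero_mem _
  | of i x =>
    induction x using Submodule.Quotient.induction_on with | _ x
    exact key i x.1 x.2
  | add x y h h' => rw [map_add]; exact add_mem h h'

end Gr

/-! ### Application of the PBW property -/

/-- If the associated graded algebra of the universal envelope is isomorphic to the free commutative
conformal algebra, then squares of nonzero elements of `L` in the envelope are not torsion. -/
theorem eq_zero_of_nprod_mem_torsion {k : Type u} [Field k] [CharZero k]
    {L : Type v} [AddCommGroup L] [Module k[X] L] [NProducts L] [Module.Finite k[X] L]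
    {β : Type w} (B : Module.Basis β k[X] L) {N : ℕ} (hN : 1 ≤ N)
    (e : Iso k (Gr k (Set.range fun x : β => Envelope.ι B (fun _ _ => N) (B x)))
      (FreeComm k (fun _ _ : β => N))) (a : L)
    (ha : ∀ n, nprod n (Envelope.ι B (fun _ _ => N) a) (Envelope.ι B (fun _ _ => N) a) ∈
      Submodule.torsion k[X] (Envelope B fun _ _ => N)) : a = 0 := by
  classical
  have : Finite β := Module.Finite.finite_basis B
  have := Fintype.ofFinite β
  set ι := Envelope.ι B (fun _ _ => N)
  set S := Set.range fun x : β => ι (B x)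
  have hι : ∀ x, ι x ∈ filt k S 1 := by
    intro x
    have hx : x ∈ Submodule.span k[X] (Set.range B) := B.span_eq ▸ Submodule.mem_top
    induction hx using Submodule.span_induction with
    | mem x hx => obtain ⟨x, rfl⟩ := hx; exact mem_filt_one ⟨x, rfl⟩
    | zero => rw [map_zero]; exact zero_mem _
    | add x y _ _ h h' => rw [map_add]; exact add_mem h h'
    | smul f x _ h => rw [map_smul]; exact Submodule.smul_mem _ _ h
  let δ : L →ₗ[k[X]] Gr k S := grMk k S 1 ∘ₗ ι.codRestrict (filt k S 1) hι
  -- One homomorphism for each `i`, reading off the linear part in the `i`-th generator. The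
  -- locality bound holds as soon as `N ≥ 1`, since constants have only a `0`-product.
  let γ : β → β → CurTrunc k := fun i x => ((C (if i = x then 1 else 0), 0) : k[X] × k[X])
  have hγ : ∀ (i : β) (n : ℕ) (x y : β), N ≤ n → nprod n (γ i x) (γ i y) = 0 :=
    fun i n x y hn => Prod.ext rfl (curProd_C_C (by omega) _ _)
  let h : ∀ i : β, FreeComm k (fun _ _ : β => N) →ₗ[k[X]] CurTrunc k :=
    fun i => FreeComm.lift (γ i) (hγ i) CurTrunc.nprod_comm
  let Γ : ∀ i : β, Gr k S →ₗ[k[X]] CurTrunc k := fun i => h i ∘ₗ e.toLinearEquiv.toLinearMap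
  have hΓ : ∀ i n x y, Γ i (nprod n x y) = nprod n (Γ i x) (Γ i y) := fun i n x y =>
    (congrArg (h i) (e.map_nprod n x y)).trans (FreeComm.lift_nprod _ _ _ n _ _)
  let Γ₁ : Gr k S →ₗ[k[X]] β → k[X] :=
    LinearMap.pi fun i => (LinearMap.fst k[X] k[X] k[X] : CurTrunc k →ₗ[k[X]] k[X]) ∘ₗ Γ i
  -- The generators of the free commutative algebra go to the standard basis; their preimages under
  -- `e` may be inhomogeneous.
  have hΓ₁ : LinearMap.range Γ₁ = ⊤ := by
    rw [eq_top_iff, ← (Pi.basisFun k[X] β).span_eq, Submodule.span_le]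
    rintro _ ⟨x, rfl⟩
    refine ⟨e.toLinearEquiv.symm (Submodule.Quotient.mk (FreeAssoc.of k _ x)), funext fun i => ?_⟩
    change (h i (e.toLinearEquiv (e.toLinearEquiv.symm _))).1 = _
    rw [LinearEquiv.apply_symm_apply]
    change C (if i = x then 1 else 0) = _
    rw [Pi.basisFun_apply, Pi.single_apply]
    split_ifs <;> simp
  -- Products in the truncated algebra have no component along `x`, so `Γ₁` kills products and its
  -- whole image already comes from degree one.
  have hσ : Function.Surjective (Γ₁ ∘ₗ δ) := by
    rw [← LinearMap.range_eq_top, eq_top_iff, ← hΓ₁]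
    refine range_le_of_nprod S Γ₁ _ (fun n x y => funext fun i => ?_) ?_
    · change (Γ i (nprod n x y)).1 = 0
      rw [hΓ]; rfl
    · rintro _ ⟨x, rfl⟩
      exact ⟨B x, rfl⟩
  -- A surjective endomorphism of the finitely generated module `L` is injective.
  have hinj : Function.Injective (B.equivFun.symm.toLinearMap ∘ₗ Γ₁ ∘ₗ δ) :=
    OrzechProperty.injective_of_surjective_endomorphism _
      (B.equivFun.symm.surjective.comp hσ)
  refine hinj ?_
  rw [map_zero, LinearMap.comp_apply, LinearEquiv.coe_coe, LinearEquiv.map_eq_zero_iff]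
  funext i
  by_contra hi
  obtain ⟨n, hn⟩ := curProd_ne_zero hi hi
  obtain ⟨⟨f, hf⟩, hfa⟩ := (Submodule.mem_torsion_iff _).1 (ha n)
  -- The product of the degree one classes is the degree two class of the product in the envelope,
  -- so it inherits the annihilator `f`.
  have h1 : f • nprod n (δ a) (δ a) = 0 := by
    change f • nprod n (grMk k S 1 ⟨ι a, hι a⟩) (grMk k S 1 ⟨ι a, hι a⟩) = 0
    rw [nprod_grMk, ← map_smul]
    exact (congrArg (grMk k S (1 + 1)) (Subtype.ext hfa)).trans (map_zero _)
  have h2 := congrArg (Γ i) h1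
  rw [map_smul, hΓ, map_zero] at h2
  have h3 : f * curProd n (Γ i (δ a)).1 (Γ i (δ a)).1 = 0 := congrArg Prod.snd h2
  exact hn ((mul_eq_zero.1 h3).resolve_left (nonZeroDivisors.ne_zero hf))

end Conformal

theorem mainTheorem4 {k : Type u} [Field k] [CharZero k]
    {L : Type v} [AddCommGroup L] [Module k[X] L] [Conformal.NProducts L]
    [Conformal.IsLieConformalAlgebra k L] [Module.Finite k[X] L] [Module.IsTorsionFree k[X] L]
    {β : Type w} (B : Module.Basis β k[X] L) (hPBW : Conformal.HasPBWProperty B) :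
    ∃ (M : Type u) (_ : AddCommGroup M) (_ : Module k[X] M),
      Module.Finite k[X] M ∧ Module.Free k[X] M ∧
        ∃ ρ : Conformal.Representation k L M, ρ.IsFaithful := by
  obtain ⟨N₀, hN₀⟩ := hPBW
  -- A single value of `N` suffices, and the successor guarantees `N ≥ 1`.
  obtain ⟨e⟩ := hN₀ (N₀ + 1) (Nat.le_succ N₀)
  exact Conformal.exists_faithful_free_of_nprod_notMem_torsion _
    (Conformal.Envelope.ι_nprod B fun _ _ => N₀ + 1)
    (Conformal.eq_zero_of_nprod_mem_torsion B (Nat.le_add_left 1 N₀) e)
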